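/- Let $\mathfrak A$ be a (complex, not necessarily unital) Banach algebra, and let $S$ be a finite semilattice, i.e. a finite commutative semigroup in which $ss=s$ for every $s$. Suppose that $\mathfrak A$ is graded over $S$: there are closed subspaces $\mathfrak A_s\subseteq\mathfrak A$ $(s\in S)$ such that $$\mathfrak A=\ell^1\text{-}\bigoplus_{s\in S}\mathfrak A_s\qquad\text{and}\qquad \mathfrak A_s\mathfrak A_t\subseteq\mathfrak A_{st}\quad (s,t\in S),$$ where the first condition means that every $a\in\mathfrak A$ is of the form $a=\sum_{s\in S}a_s$ with $a_s\in\mathfrak A_s$, and that $\bigl\|\sum_{s\in S}a_s\bigr\|=\sum_{s\in S}\|a_s\|$ for every choice of $a_s\in\mathfrak A_s$. (Each $\mathfrak A_s$ is then a closed subalgebra of $\mathfrak A$, hence a Banach algebra.) Then $\mathfrak A$ is amenable if and only if $\mathfrak A_s$ is amenable for every $s\in S$. Here a Banach algebra $\mathfrak B$ is called amenable if there is a bounded net $(D_\alpha)$ in the projective tensor product $\mathfrak B\otimes^\gamma\mathfrak B$ such that, for each $b\in\mathfrak B$, $$\lim_\alpha b\,m(D_\alpha)=b=\lim_\alpha m(D_\alpha)\,b\qquad\text{and}\qquad\lim_\alpha\,(b\cdot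 D_\alpha-D_\alpha\cdot b)=0,$$ where $m:\mathfrak B\otimes^\gamma\mathfrak B\to\mathfrak B$ is the multiplication map $m(c\otimes d)=cd$, and the module actions are given by $b\cdot(c\otimes d)=(bc)\otimes d$ and $(c\otimes d)\cdot b=c\otimes(db)$. -/

import Mathlib

open Filter Topology
open scoped TensorProduct

noncomputable section

universe u v

section Amenable

/-! A (complex, not necessarily unital) Banach algebra is a complete `NonUnitalNormedRing` over `ℂ`
whose scalars are compatible with the multiplication. -/

variable (A : Type u) [NonUnitalNormedRing A] [NormedSpace ℂ A]
  [IsScalarTower ℂ A A] [SMulCommClass ℂ A A]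

/-- The projective tensor product `A ⊗^γ A`: the completion of the algebraic tensor product of two
copies of `A` for the projective norm (the norm which Mathlib puts on `⨂[ℂ] _ : Fin 2, A`, i.e.
the infimum of `∑ j, ‖b j‖ * ‖c j‖` over all representations `∑ j, b j ⊗ c j`). -/
abbrev ProjTensorSq : Type u := UniformSpace.Completion (⨂[ℂ] _ : Fin 2, A)

namespace ProjTensorSq

variable {A}

/-- The elementary tensor `b ⊗ c` in `A ⊗^γ A`. -/
def tmul (b c : A) : ProjTensorSq A :=
  ((PiTensorProduct.tprod ℂ ![b, c] : ⨂[ℂ] _ : Fin 2, A) : ProjTensorSq A)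

variable (A) in
/-- The multiplication of `A` as a continuous multilinear map of two variables. -/
def mulMultilinear : ContinuousMultilinearMap ℂ (fun _ : Fin 2 => A) A :=
  MultilinearMap.mkContinuous
    (MultilinearMap.mk' (fun v : Fin 2 → A => v 0 * v 1)
      (fun v i x y => by fin_cases i <;> simp [add_mul, mul_add])
      (fun v i c x => by fin_cases i <;> simp [smul_mul_assoc, mul_smul_comm]))
    1 (fun v => by simpa using norm_mul_le (v 0) (v 1))

variable (A) in
/-- The multiplication map `m : A ⊗^γ A → A`, `m (b ⊗ c) = b * c`. -/
def mulMap [CompleteSpace A] : ProjTensorSq A →L[ℂ] A :=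
  (PiTensorProduct.liftIsometry ℂ (fun _ : Fin 2 => A) A (mulMultilinear A)).fromCompletion

/-- The left action of `A` on `A ⊗^γ A`: `a · (b ⊗ c) = (a * b) ⊗ c`. -/
def lact (a : A) : ProjTensorSq A →L[ℂ] ProjTensorSq A :=
  (PiTensorProduct.mapL (E := fun _ : Fin 2 => A) (E' := fun _ : Fin 2 => A)
    ![ContinuousLinearMap.mul ℂ A a, ContinuousLinearMap.id ℂ A]).completion

/-- The right action of `A` on `A ⊗^γ A`: `(b ⊗ c) · a = b ⊗ (c * a)`. -/
def ract (a : A) : ProjTensorSq A →L[ℂ] ProjTensorSq A :=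
  (PiTensorProduct.mapL (E := fun _ : Fin 2 => A) (E' := fun _ : Fin 2 => A)
    ![ContinuousLinearMap.id ℂ A, (ContinuousLinearMap.mul ℂ A).flip a]).completion

theorem mulMap_tmul [CompleteSpace A] (b c : A) : mulMap A (tmul b c) = b * c := by
  simp [mulMap, tmul, mulMultilinear]

theorem lact_tmul (a b c : A) : lact a (tmul b c) = tmul (a * b) c := by
  simp only [lact, tmul, ContinuousLinearMap.coe_completion]
  rw [UniformSpace.Completion.map_coe (ContinuousLinearMap.uniformContinuous _)]
  congr 1
  rw [PiTensorProduct.mapL_apply, PiTensorProduct.map_tprod]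
  congr 1
  ext i
  fin_cases i <;> simp

theorem ract_tmul (a b c : A) : ract a (tmul b c) = tmul b (c * a) := by
  simp only [ract, tmul, ContinuousLinearMap.coe_completion]
  rw [UniformSpace.Completion.map_coe (ContinuousLinearMap.uniformContinuous _)]
  congr 1
  rw [PiTensorProduct.mapL_apply, PiTensorProduct.map_tprod]
  congr 1
  ext i
  fin_cases i <;> simp

end ProjTensorSq

variable {A} in
/-- A net `D` in `A ⊗^γ A`, indexed by a directed set, is a bounded approximate diagonal if it is
bounded, `(m (D i))` is an approximate identity of `A` (automatically bounded), and
`a · D i - D i · a → 0` for every `a`. -/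
structure IsBoundedApproxDiagonal [CompleteSpace A] {ι : Type*} [Preorder ι]
    (D : ι → ProjTensorSq A) : Prop where
  bounded : ∃ C : ℝ, ∀ i, ‖D i‖ ≤ C
  mul_mulMap : ∀ a : A, Tendsto (fun i => a * ProjTensorSq.mulMap A (D i)) atTop (𝓝 a)
  mulMap_mul : ∀ a : A, Tendsto (fun i => ProjTensorSq.mulMap A (D i) * a) atTop (𝓝 a)
  central : ∀ a : A,
    Tendsto (fun i => ProjTensorSq.lact a (D i) - ProjTensorSq.ract a (D i)) atTop (𝓝 0)

/-- A Banach algebra is amenable if it admits a bounded approximate diagonal. (Index sets in the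
universe of `A` suffice: a net indexed by anything else can be replaced by one which is indexed by
the pairs of a finite subset of `A` and a natural number.) -/
def IsAmenable [CompleteSpace A] : Prop :=
  ∃ (ι : Type u) (_ : Preorder ι) (_ : IsDirectedOrder ι) (_ : Nonempty ι)
    (D : ι → ProjTensorSq A), IsBoundedApproxDiagonal D

end Amenable

section Graded

variable {A : Type u} [NonUnitalNormedRing A] [NormedSpace ℂ A]
variable {S : Type v} [CommSemigroup S] [Fintype S]

/-- `A` is graded over the finite semigroup `S` by the closed subspaces `𝒜 s`: `A` is their
`ℓ¹`-direct sum (every element is a sum of components, and the norm of a sum is the sum of the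
norms, so that the components are unique), and `𝒜 s * 𝒜 t ⊆ 𝒜 (s * t)`. -/
structure IsGradedOver (𝒜 : S → Submodule ℂ A) : Prop where
  isClosed : ∀ s, IsClosed (𝒜 s : Set A)
  exists_sum : ∀ a : A, ∃ x : ∀ s, 𝒜 s, ∑ s, (x s : A) = a
  norm_sum : ∀ x : ∀ s, 𝒜 s, ‖∑ s, (x s : A)‖ = ∑ s, ‖(x s : A)‖
  mul_mem : ∀ s t : S, ∀ a ∈ 𝒜 s, ∀ b ∈ 𝒜 t, a * b ∈ 𝒜 (s * t)

namespace IsGradedOver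

variable {𝒜 : S → Submodule ℂ A}

/-- If every element of `S` is idempotent, then each component `𝒜 s` is a subalgebra of `A`; it
carries the norm of `A`. -/
def component (h : IsGradedOver 𝒜) (hS : ∀ s : S, s * s = s) (s : S) :
    NonUnitalSubalgebra ℂ A :=
  { 𝒜 s with
    mul_mem' := fun {a b} ha hb => by
      have := h.mul_mem s s a ha b hb
      rwa [hS s] at this }

instance instNormedSpaceComponent (h : IsGradedOver 𝒜) (hS : ∀ s : S, s * s = s) (s : S) :
    NormedSpace ℂ (h.component hS s) where
  norm_smul_le c x := norm_smul_le c (x : A)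

/-- The components are closed, hence Banach algebras. -/
instance instCompleteSpaceComponent [CompleteSpace A] (h : IsGradedOver 𝒜) (hS : ∀ s : S, s * s = s) (s : S) :
    CompleteSpace (h.component hS s) :=
  (h.isClosed s).completeSpace_coe

end IsGradedOver

end Graded

end

/-! Order `S` by s ≤ t iff st = s.

From A to a component: the indices above s are closed under products and the remaining ones form an
ideal of `S`, so the projection Q of A onto the sum of the components above s is a bounded
homomorphism. A_s is an ideal in the range of Q, complemented by the projection P. If D = ∑ b ⊗ c is
approximately central, moving x ∈ A_s across D shows that ∑ P(Qb) Qc is a left approximate unit for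
A_s. Together with its mirror image it gives a two-sided one, e, and ∑ e Q(b) ⊗ Q(c) e is an
approximate diagonal of A_s (`IsComplementedIdealOfRetract.isAmenable`).

From the components to A: build up the ideals of `S` one index at a time. Each step extends an
approximate diagonal D of a closed ideal I by an approximate diagonal E of a component C
(`exists_isApproxDiagFor_sup`), using f·D + (1 - f)·E·(1 - f'). Here f and f' run through a bounded
approximate identity of I that asymptotically commutes with C. It is obtained by averaging an
approximate identity of I over an approximate diagonal of the unitization of C
(`exists_isQuasicentralUnit`). Two variables are needed because f + (1 - f)(1 - f') = 1 - f' + f f',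
and f f' → f' when f moves with f' fixed, whereas f² - f need not tend to zero.

All limits are iterated, so nets are replaced by filters and `Filter.curry`. In `IsApproxDiagFor`
the tensors live in A ⊗ A and only their products must lie in the subspace; no tensor square of a
partial sum is ever formed. -/

namespace ProjTensorSq

/-! ### Elementary tensors and tensor products of operators -/

section Basic

variable {A : Type*} [NonUnitalNormedRing A] [NormedSpace ℂ A]

theorem tmul_add_left (b b' c : A) : tmul (b + b') c = tmul b c + tmul b' c := by
  have := (PiTensorProduct.tprod ℂ : MultilinearMap ℂ (fun _ : Fin 2 => A) _).map_update_add
    ![b, c] 0 b b'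
  simp only [tmul, ← UniformSpace.Completion.coe_add]
  congr 1
  convert this using 2
  all_goals (congr 1; ext i; fin_cases i <;> simp)

theorem tmul_sub_left (b b' c : A) : tmul (b - b') c = tmul b c - tmul b' c := by
  rw [eq_sub_iff_add_eq, ← tmul_add_left, sub_add_cancel]

theorem tmul_add_right (b c c' : A) : tmul b (c + c') = tmul b c + tmul b c' := by
  have := (PiTensorProduct.tprod ℂ : MultilinearMap ℂ (fun _ : Fin 2 => A) _).map_update_add
    ![b, c] 1 c c'
  simp only [tmul, ← UniformSpace.Completion.coe_add]
  congr 1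
  convert this using 2
  all_goals (congr 1; ext i; fin_cases i <;> simp)

theorem tmul_sub_right (b c c' : A) : tmul b (c - c') = tmul b c - tmul b c' := by
  rw [eq_sub_iff_add_eq, ← tmul_add_right, sub_add_cancel]

/-- A closed subspace of `A ⊗^γ A` which contains the elementary tensors is everything. -/
theorem mem_of_isClosed (W : Submodule ℂ (ProjTensorSq A)) (hW : IsClosed (W : Set (ProjTensorSq A)))
    (h : ∀ b c, tmul b c ∈ W) (D : ProjTensorSq A) : D ∈ W := by
  induction D using UniformSpace.Completion.induction_on with
  | hp => exact hW
  | ih x =>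
    induction x using PiTensorProduct.induction_on with
    | smul_tprod r f =>
      rw [UniformSpace.Completion.coe_smul]
      refine W.smul_mem r ?_
      have : f = ![f 0, f 1] := by ext i; fin_cases i <;> rfl
      rw [this]
      exact h _ _
    | add x y hx hy =>
      rw [UniformSpace.Completion.coe_add]
      exact W.add_mem hx hy

/-- Elementary tensors span a dense subspace; every operator identity on A ⊗ A below is checked on
them through this lemma. -/
theorem clm_ext {F : Type*} [NormedAddCommGroup F] [NormedSpace ℂ F]
    {T T' : ProjTensorSq A →L[ℂ] F} (h : ∀ b c, T (tmul b c) = T' (tmul b c)) : T = T' := by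
  ext D
  have := mem_of_isClosed (LinearMap.ker (T - T').toLinearMap)
    (T - T').isClosed_ker (fun b c => by simp [h]) D
  simpa [sub_eq_zero] using this

/-- A continuous linear map sends `A ⊗^γ A` into a closed subspace as soon as it does so for the
elementary tensors. -/
theorem clm_mem {F : Type*} [NormedAddCommGroup F] [NormedSpace ℂ F]
    (T : ProjTensorSq A →L[ℂ] F) (W : Submodule ℂ F) (hW : IsClosed (W : Set F))
    (h : ∀ b c, T (tmul b c) ∈ W) (D : ProjTensorSq A) : T D ∈ W :=
  mem_of_isClosed (W.comap T.toLinearMap) (hW.preimage T.continuous) h D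

variable {B : Type*} [NonUnitalNormedRing B] [NormedSpace ℂ B]

/-- The projective tensor product `T ⊗ U` of two bounded operators. -/
noncomputable def mapSq (T U : A →L[ℂ] B) : ProjTensorSq A →L[ℂ] ProjTensorSq B :=
  (PiTensorProduct.mapL (E := fun _ : Fin 2 => A) (E' := fun _ : Fin 2 => B) ![T, U]).completion

theorem mapSq_tmul (T U : A →L[ℂ] B) (b c : A) : mapSq T U (tmul b c) = tmul (T b) (U c) := by
  simp only [mapSq, tmul, ContinuousLinearMap.completion_apply_coe]
  congr 1
  rw [PiTensorProduct.mapL_apply, PiTensorProduct.map_tprod]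
  congr 1
  ext i
  fin_cases i <;> simp

theorem norm_mapSq_apply_le (T U : A →L[ℂ] B) (D : ProjTensorSq A) :
    ‖mapSq T U D‖ ≤ ‖T‖ * ‖U‖ * ‖D‖ := by
  induction D using UniformSpace.Completion.induction_on with
  | hp => exact isClosed_le (by fun_prop) (by fun_prop)
  | ih x =>
    rw [mapSq, ContinuousLinearMap.completion_apply_coe, UniformSpace.Completion.norm_coe,
      UniformSpace.Completion.norm_coe]
    refine (ContinuousLinearMap.le_opNorm _ _).trans ?_
    gcongr
    exact (PiTensorProduct.opNorm_mapL _).trans (by simp)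

theorem mapSq_sub_left (T T' U : A →L[ℂ] B) (D : ProjTensorSq A) :
    mapSq (T - T') U D = mapSq T U D - mapSq T' U D := by
  have : mapSq (T - T') U = mapSq T U - mapSq T' U :=
    clm_ext fun b c => by simp [mapSq_tmul, tmul_sub_left]
  rw [this]; rfl

theorem mapSq_sub_right (T U U' : A →L[ℂ] B) (D : ProjTensorSq A) :
    mapSq T (U - U') D = mapSq T U D - mapSq T U' D := by
  have : mapSq T (U - U') = mapSq T U - mapSq T U' :=
    clm_ext fun b c => by simp [mapSq_tmul, tmul_sub_right]
  rw [this]; rfl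

end Basic

/-! ### Module actions, multiplication and averaging on A ⊗ A -/

section Algebra

variable {A : Type*} [NonUnitalNormedRing A] [NormedSpace ℂ A]
  [IsScalarTower ℂ A A] [SMulCommClass ℂ A A]

theorem norm_lact_apply_le (a : A) (D : ProjTensorSq A) : ‖lact a D‖ ≤ ‖a‖ * ‖D‖ := by
  refine (norm_mapSq_apply_le (ContinuousLinearMap.mul ℂ A a) (.id ℂ A) D).trans ?_
  gcongr
  calc _ ≤ ‖a‖ * 1 := by
        gcongr
        · exact ContinuousLinearMap.opNorm_mul_apply_le ℂ A a
        · exact ContinuousLinearMap.norm_id_le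
    _ = _ := mul_one _

theorem norm_mul_flip_le (a : A) : ‖(ContinuousLinearMap.mul ℂ A).flip a‖ ≤ ‖a‖ :=
  ContinuousLinearMap.opNorm_le_bound _ (norm_nonneg _) fun b => by
    simpa [mul_comm] using norm_mul_le b a

theorem norm_ract_apply_le (a : A) (D : ProjTensorSq A) : ‖ract a D‖ ≤ ‖D‖ * ‖a‖ := by
  refine (norm_mapSq_apply_le (.id ℂ A) ((ContinuousLinearMap.mul ℂ A).flip a) D).trans ?_
  rw [mul_comm]
  gcongr
  calc _ ≤ 1 * ‖a‖ := by
        gcongr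
        · exact ContinuousLinearMap.norm_id_le
        · exact norm_mul_flip_le a
    _ = _ := one_mul _

theorem lact_sub (a b : A) (D : ProjTensorSq A) : lact (a - b) D = lact a D - lact b D := by
  have : lact (a - b) = lact a - lact b := clm_ext fun x y => by
    simp [lact_tmul, sub_mul, tmul_sub_left]
  rw [this]; rfl

theorem ract_sub (a b : A) (D : ProjTensorSq A) : ract (a - b) D = ract a D - ract b D := by
  have : ract (a - b) = ract a - ract b := clm_ext fun x y => by
    simp [ract_tmul, mul_sub, tmul_sub_right]
  rw [this]; rfl

theorem lact_add (a b : A) (D : ProjTensorSq A) : lact (a + b) D = lact a D + lact b D := by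
  rw [← sub_eq_iff_eq_add, ← lact_sub, add_sub_cancel_right]

theorem ract_add (a b : A) (D : ProjTensorSq A) : ract (a + b) D = ract a D + ract b D := by
  rw [← sub_eq_iff_eq_add, ← ract_sub, add_sub_cancel_right]

theorem lact_mul (a b : A) (D : ProjTensorSq A) : lact (a * b) D = lact a (lact b D) := by
  have : lact (a * b) = (lact a).comp (lact b) := clm_ext fun x y => by
    simp [lact_tmul, mul_assoc]
  rw [this]; rfl

theorem ract_mul (a b : A) (D : ProjTensorSq A) : ract (a * b) D = ract b (ract a D) := by
  have : ract (a * b) = (ract b).comp (ract a) := clm_ext fun x y => by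
    simp [ract_tmul, mul_assoc]
  rw [this]; rfl

theorem ract_lact (a b : A) (D : ProjTensorSq A) : ract b (lact a D) = lact a (ract b D) := by
  have : (ract b).comp (lact a) = (lact a).comp (ract b) := clm_ext fun x y => by
    simp [lact_tmul, ract_tmul]
  exact congr($this D)

variable [CompleteSpace A]

theorem mulMap_lact (a : A) (D : ProjTensorSq A) : mulMap A (lact a D) = a * mulMap A D := by
  have : (mulMap A).comp (lact a) = (ContinuousLinearMap.mul ℂ A a).comp (mulMap A) :=
    clm_ext fun x y => by simp [lact_tmul, mulMap_tmul, mul_assoc]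
  exact congr($this D)

theorem mulMap_ract (a : A) (D : ProjTensorSq A) : mulMap A (ract a D) = mulMap A D * a := by
  have : (mulMap A).comp (ract a) = ((ContinuousLinearMap.mul ℂ A).flip a).comp (mulMap A) :=
    clm_ext fun x y => by simp [ract_tmul, mulMap_tmul, mul_assoc]
  exact congr($this D)

/-- The map `b ⊗ c ↦ b * e * c`. -/
noncomputable def sandwich (e : A) : ProjTensorSq A →L[ℂ] A :=
  (mulMap A).comp (mapSq (.id ℂ A) (ContinuousLinearMap.mul ℂ A e))

theorem sandwich_tmul (e b c : A) : sandwich e (tmul b c) = b * e * c := by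
  simp [sandwich, mapSq_tmul, mulMap_tmul, mul_assoc]

theorem sandwich_lact (e a : A) (D : ProjTensorSq A) :
    sandwich e (lact a D) = a * sandwich e D := by
  have : (sandwich e).comp (lact a) = (ContinuousLinearMap.mul ℂ A a).comp (sandwich e) :=
    clm_ext fun x y => by simp [lact_tmul, sandwich_tmul, mul_assoc]
  exact congr($this D)

theorem sandwich_ract (e a : A) (D : ProjTensorSq A) :
    sandwich e (ract a D) = sandwich e D * a := by
  have : (sandwich e).comp (ract a) = ((ContinuousLinearMap.mul ℂ A).flip a).comp (sandwich e) :=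
    clm_ext fun x y => by simp [ract_tmul, sandwich_tmul, mul_assoc]
  exact congr($this D)

theorem norm_sandwich_apply_le (e : A) (D : ProjTensorSq A) :
    ‖sandwich e D‖ ≤ ‖mulMap A‖ * (‖e‖ * ‖D‖) := by
  refine ((mulMap A).le_opNorm _).trans ?_
  gcongr
  refine (norm_mapSq_apply_le _ _ D).trans ?_
  gcongr
  calc _ ≤ 1 * ‖e‖ := by
        gcongr
        · exact ContinuousLinearMap.norm_id_le
        · exact ContinuousLinearMap.opNorm_mul_apply_le ℂ A e
    _ = _ := one_mul _

end Algebra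

end ProjTensorSq

/-! ### Calculus of bounded and null families along filters -/

/-- The family `u` is eventually bounded in norm along the filter `l`. -/
def NormBdd {X E : Type*} [NormedAddCommGroup E] (l : Filter X) (u : X → E) : Prop :=
  ∃ K : ℝ, ∀ᶠ x in l, ‖u x‖ ≤ K

/-- The family `u` tends to zero along the filter `l`. -/
def Null {X E : Type*} [NormedAddCommGroup E] (l : Filter X) (u : X → E) : Prop :=
  Tendsto u l (𝓝 0)

section NullFamilies

variable {X Y E F G : Type*} [NormedAddCommGroup E] [NormedAddCommGroup F] [NormedAddCommGroup G]
  {l : Filter X} {u v : X → E}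

theorem NormBdd.const (l : Filter X) (c : E) : NormBdd l fun _ => c :=
  ⟨‖c‖, .of_forall fun _ => le_rfl⟩

theorem NormBdd.add (hu : NormBdd l u) (hv : NormBdd l v) : NormBdd l fun x => u x + v x := by
  obtain ⟨K, hK⟩ := hu
  obtain ⟨M, hM⟩ := hv
  refine ⟨K + M, ?_⟩
  filter_upwards [hK, hM] with x h1 h2
  exact (norm_add_le _ _).trans (add_le_add h1 h2)

theorem NormBdd.sub (hu : NormBdd l u) (hv : NormBdd l v) : NormBdd l fun x => u x - v x := by
  obtain ⟨K, hK⟩ := hu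
  obtain ⟨M, hM⟩ := hv
  refine ⟨K + M, ?_⟩
  filter_upwards [hK, hM] with x h1 h2
  exact (norm_sub_le _ _).trans (add_le_add h1 h2)

theorem NormBdd.of_le_mul {v : X → F} {w : X → G} (hu : NormBdd l u) (hv : NormBdd l v) (C : ℝ)
    (h : ∀ x, ‖w x‖ ≤ C * (‖u x‖ * ‖v x‖)) : NormBdd l w := by
  obtain ⟨K, hK⟩ := hu
  obtain ⟨M, hM⟩ := hv
  refine ⟨|C| * (K * M), ?_⟩
  filter_upwards [hK, hM] with x h1 h2
  have hK0 : 0 ≤ K := (norm_nonneg _).trans h1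
  refine (h x).trans ?_
  gcongr
  exact le_abs_self C

theorem NormBdd.comp_tendsto {m : Filter Y} {φ : Y → X} (hu : NormBdd l u)
    (hφ : Tendsto φ m l) : NormBdd m fun y => u (φ y) :=
  let ⟨K, hK⟩ := hu
  ⟨K, hφ.eventually hK⟩

theorem Null.comp_tendsto {m : Filter Y} {φ : Y → X} (hu : Null l u)
    (hφ : Tendsto φ m l) : Null m fun y => u (φ y) :=
  Tendsto.comp hu hφ

theorem Null.map {m : Filter Y} {φ : Y → X} (h : Null m fun y => u (φ y)) :
    Null (map φ m) u :=
  tendsto_map' h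

theorem Null.congr (hu : Null l u) (h : ∀ x, u x = v x) : Null l v :=
  Tendsto.congr h hu

theorem Null.add (hu : Null l u) (hv : Null l v) : Null l fun x => u x + v x := by
  simpa [Null] using Tendsto.add hu hv

theorem Null.sub (hu : Null l u) (hv : Null l v) : Null l fun x => u x - v x := by
  simpa [Null] using Tendsto.sub hu hv

theorem Null.of_le_mul {v : X → F} {w : X → G} (hu : Null l u) (hv : NormBdd l v) (C : ℝ)
    (h : ∀ x, ‖w x‖ ≤ C * (‖u x‖ * ‖v x‖)) : Null l w := by
  obtain ⟨M, hM⟩ := hv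
  have h0 : Tendsto (fun x => |C| * (‖u x‖ * M)) l (𝓝 0) := by
    simpa using (hu.norm.mul_const M).const_mul |C|
  refine squeeze_zero_norm' ?_ h0
  filter_upwards [hM] with x hx
  refine (h x).trans ?_
  gcongr
  exact le_abs_self C

theorem Null.clm [NormedSpace ℂ E] [NormedSpace ℂ F] (T : E →L[ℂ] F) (hu : Null l u) :
    Null l fun x => T (u x) := by
  simpa [Null, Function.comp_def] using (T.continuous.tendsto 0).comp hu

theorem NormBdd.clm [NormedSpace ℂ E] [NormedSpace ℂ F] (T : E →L[ℂ] F) (hu : NormBdd l u) :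
    NormBdd l fun x => T (u x) :=
  hu.of_le_mul (NormBdd.const l (1 : ℝ)) ‖T‖ fun x => by simpa using T.le_opNorm (u x)

/-- Iterated limits: the second variable moves while the first is held fixed, and no uniformity in
the first is required. -/
theorem Null.curry {m : Filter Y} {w : X × Y → E} (h : ∀ᶠ x in l, Null m fun y => w (x, y)) :
    Null (l.curry m) w :=
  Tendsto.curry (f := fun x y => w (x, y)) h

theorem tendsto_fst_curry (l : Filter X) (m : Filter Y) : Tendsto Prod.fst (l.curry m) l :=
  tendsto_fst.mono_left curry_le_prod

theorem tendsto_snd_curry (l : Filter X) (m : Filter Y) : Tendsto Prod.snd (l.curry m) m :=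
  tendsto_snd.mono_left curry_le_prod

theorem neBot_curry (l : Filter X) (m : Filter Y) [l.NeBot] [hm : m.NeBot] : (l.curry m).NeBot := by
  refine ⟨fun h => ?_⟩
  have : ∀ᶠ _ in l.curry m, False := by rw [h]; trivial
  rw [eventually_curry_iff] at this
  obtain ⟨x, hx⟩ := this.exists
  obtain ⟨y, hy⟩ := hx.exists
  exact hy

/-- The vectors at which an eventually bounded family of operators tends to zero form a closed
subspace. -/
theorem exists_isClosed_null [NormedSpace ℂ E] [NormedSpace ℂ F] (T : X → E →L[ℂ] F) (K : ℝ)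
    (hK : ∀ᶠ x in l, ∀ D, ‖T x D‖ ≤ K * ‖D‖) :
    ∃ W : Submodule ℂ E, IsClosed (W : Set E) ∧ ∀ D, D ∈ W ↔ Null l fun x => T x D := by
  refine ⟨{ carrier := {D | Null l fun x => T x D}
            zero_mem' := ?_
            add_mem' := ?_
            smul_mem' := ?_ }, ?_, fun D => Iff.rfl⟩
  · intro D D' h h'
    exact (Null.add h h').congr fun x => by simp
  · exact tendsto_const_nhds.congr fun x => by simp
  · intro c D h
    have := Tendsto.const_smul h c
    simpa [Null] using this
  · refine isClosed_of_closure_subset fun D hD => ?_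
    rw [Metric.mem_closure_iff] at hD
    change Tendsto _ _ _
    rw [Metric.tendsto_nhds]
    intro ε hε
    -- Chosen so that K * ‖D - D'‖ ≤ ε / 2; the `+ 1` keeps the denominator positive.
    obtain ⟨D', h', hd⟩ := hD (ε / 2 / (|K| + 1)) (by positivity)
    have h'' := (Metric.tendsto_nhds.1 h') (ε / 2) (by positivity)
    filter_upwards [hK, h''] with x h1 h2
    rw [dist_zero_right] at h2 ⊢
    have h3 : ‖T x (D - D')‖ ≤ ε / 2 := by
      refine (h1 _).trans ?_
      rw [dist_eq_norm] at hd
      have : ‖D - D'‖ * (|K| + 1) ≤ ε / 2 := by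
        rw [← le_div_iff₀ (by positivity)]
        exact hd.le
      nlinarith [le_abs_self K, norm_nonneg (D - D')]
    calc ‖T x D‖ = ‖T x (D - D') + T x D'‖ := by rw [← map_add, sub_add_cancel]
      _ ≤ _ := norm_add_le _ _
      _ < ε := by linarith

end NullFamilies

/-! ### Products and module actions of bounded and null families -/

section NullAlgebra

variable {X A : Type*} [NonUnitalNormedRing A] {l : Filter X} {u v : X → A}

theorem NormBdd.mul (hu : NormBdd l u) (hv : NormBdd l v) : NormBdd l fun x => u x * v x :=
  hu.of_le_mul hv 1 fun x => by simpa using norm_mul_le _ _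

theorem Null.mul_bdd (hu : Null l u) (hv : NormBdd l v) : Null l fun x => u x * v x :=
  hu.of_le_mul hv 1 fun x => by simpa using norm_mul_le _ _

theorem NormBdd.mul_null (hu : NormBdd l u) (hv : Null l v) : Null l fun x => u x * v x :=
  hv.of_le_mul hu 1 fun x => by simpa [mul_comm ‖v x‖] using norm_mul_le (u x) (v x)

variable [NormedSpace ℂ A] [IsScalarTower ℂ A A] [SMulCommClass ℂ A A] {D : X → ProjTensorSq A}

theorem NormBdd.lact (hu : NormBdd l u) (hD : NormBdd l D) :
    NormBdd l fun x => ProjTensorSq.lact (u x) (D x) :=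
  hu.of_le_mul hD 1 fun x => by simpa using ProjTensorSq.norm_lact_apply_le _ _

theorem NormBdd.ract (hu : NormBdd l u) (hD : NormBdd l D) :
    NormBdd l fun x => ProjTensorSq.ract (u x) (D x) :=
  hD.of_le_mul hu 1 fun x => by simpa using ProjTensorSq.norm_ract_apply_le _ _

theorem Null.lact (hu : Null l u) (hD : NormBdd l D) :
    Null l fun x => ProjTensorSq.lact (u x) (D x) :=
  hu.of_le_mul hD 1 fun x => by simpa using ProjTensorSq.norm_lact_apply_le _ _

theorem NormBdd.lact_null (hu : NormBdd l u) (hD : Null l D) :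
    Null l fun x => ProjTensorSq.lact (u x) (D x) :=
  hD.of_le_mul hu 1 fun x => by
    simpa [mul_comm ‖D x‖] using ProjTensorSq.norm_lact_apply_le (u x) (D x)

theorem Null.ract (hu : Null l u) (hD : NormBdd l D) :
    Null l fun x => ProjTensorSq.ract (u x) (D x) :=
  hu.of_le_mul hD 1 fun x => by
    simpa [mul_comm ‖u x‖] using ProjTensorSq.norm_ract_apply_le (u x) (D x)

theorem NormBdd.ract_null (hu : NormBdd l u) (hD : Null l D) :
    Null l fun x => ProjTensorSq.ract (u x) (D x) :=
  hD.of_le_mul hu 1 fun x => by simpa using ProjTensorSq.norm_ract_apply_le _ _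

variable [CompleteSpace A]

theorem NormBdd.sandwich (hu : NormBdd l u) (hD : NormBdd l D) :
    NormBdd l fun x => ProjTensorSq.sandwich (u x) (D x) :=
  hu.of_le_mul hD _ fun _ => ProjTensorSq.norm_sandwich_apply_le _ _

theorem NormBdd.sandwich_null (hu : NormBdd l u) (hD : Null l D) :
    Null l fun x => ProjTensorSq.sandwich (u x) (D x) :=
  hD.of_le_mul hu ‖ProjTensorSq.mulMap A‖ fun x => by
    simpa [mul_comm ‖D x‖] using ProjTensorSq.norm_sandwich_apply_le (u x) (D x)

end NullAlgebra

/-! ### Averaging an approximate identity of an ideal -/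

section Extension

variable {A : Type*} [NonUnitalNormedRing A] [NormedSpace ℂ A]
  [IsScalarTower ℂ A A] [SMulCommClass ℂ A A] [CompleteSpace A]

open ProjTensorSq

/-- The filter `l` on `A ⊗^γ A` is a bounded approximate diagonal for the elements of `B`. -/
structure IsApproxDiagFor (B : Submodule ℂ A) (l : Filter (ProjTensorSq A)) : Prop where
  neBot : l.NeBot
  bdd : NormBdd l fun D => D
  mem : ∀ᶠ D in l, mulMap A D ∈ B
  mul_mulMap : ∀ a ∈ B, Null l fun D => a * mulMap A D - a
  mulMap_mul : ∀ a ∈ B, Null l fun D => mulMap A D * a - a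
  central : ∀ a ∈ B, Null l fun D => lact a D - ract a D

/-- The filter `l` is a bounded approximate identity of `I` which asymptotically commutes with
`C`. -/
structure IsQuasicentralUnit (I C : Submodule ℂ A) (l : Filter A) : Prop where
  neBot : l.NeBot
  bdd : NormBdd l fun f => f
  mem : ∀ᶠ f in l, f ∈ I
  mul_unit : ∀ a ∈ I, Null l fun f => a * f - a
  unit_mul : ∀ a ∈ I, Null l fun f => f * a - a
  comm : ∀ a ∈ C, Null l fun f => a * f - f * a

section Sandwich

variable {X : Type*} {l : Filter X} {e : X → A} {I : Submodule ℂ A}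

/-- By boundedness it suffices to treat E = b ⊗ c. There the difference is b(e(ca) - ca), and ca
lies in the left ideal I, on which e is an approximate unit. -/
theorem null_sandwich_mul (hb : NormBdd l e) (hl : ∀ a : A, ∀ b ∈ I, a * b ∈ I)
    (hu : ∀ a ∈ I, Null l fun x => e x * a - a) {a : A} (ha : a ∈ I) (E : ProjTensorSq A) :
    Null l fun x => sandwich (e x) E * a - mulMap A E * a := by
  obtain ⟨K, hK⟩ := hb
  obtain ⟨W, hW, hmem⟩ := exists_isClosed_null (l := l)
    (fun x => ((ContinuousLinearMap.mul ℂ A).flip a).comp (sandwich (e x) - mulMap A))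
    ((‖mulMap A‖ * K + ‖mulMap A‖) * ‖a‖) (by
      filter_upwards [hK] with x hx D
      refine (norm_mul_le _ _).trans ?_
      rw [mul_right_comm, add_mul]
      gcongr
      refine (norm_sub_le _ _).trans (add_le_add ?_ ((mulMap A).le_opNorm D))
      refine (norm_sandwich_apply_le _ _).trans ?_
      rw [mul_assoc]
      gcongr)
  refine ((hmem E).1 (mem_of_isClosed W hW (fun b c => (hmem _).2 ?_) E)).congr
    fun x => by simp
  refine ((NormBdd.const l b).mul_null (hu (c * a) (hl c a ha))).congr fun x => ?_
  simp [sandwich_tmul, mulMap_tmul, mul_sub, mul_assoc]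

theorem null_mul_sandwich (hb : NormBdd l e) (hr : ∀ a ∈ I, ∀ b : A, a * b ∈ I)
    (hu : ∀ a ∈ I, Null l fun x => a * e x - a) {a : A} (ha : a ∈ I) (E : ProjTensorSq A) :
    Null l fun x => a * sandwich (e x) E - a * mulMap A E := by
  obtain ⟨K, hK⟩ := hb
  obtain ⟨W, hW, hmem⟩ := exists_isClosed_null (l := l)
    (fun x => (ContinuousLinearMap.mul ℂ A a).comp (sandwich (e x) - mulMap A))
    (‖a‖ * (‖mulMap A‖ * K + ‖mulMap A‖)) (by
      filter_upwards [hK] with x hx D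
      refine (norm_mul_le _ _).trans ?_
      rw [mul_assoc, add_mul]
      gcongr
      refine (norm_sub_le _ _).trans (add_le_add ?_ ((mulMap A).le_opNorm D))
      refine (norm_sandwich_apply_le _ _).trans ?_
      rw [mul_assoc]
      gcongr)
  refine ((hmem E).1 (mem_of_isClosed W hW (fun b c => (hmem _).2 ?_) E)).congr
    fun x => by simp
  refine ((hu (a * b) (hr a ha b)).mul_bdd (NormBdd.const l c)).congr fun x => ?_
  simp [sandwich_tmul, mulMap_tmul, sub_mul, mul_assoc]

end Sandwich

end Extension

section Extension

variable {A : Type*} [NonUnitalNormedRing A] [NormedSpace ℂ A]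
  [IsScalarTower ℂ A A] [SMulCommClass ℂ A A] [CompleteSpace A]

open ProjTensorSq

/-! ### Quasicentral approximate identities -/

section Quasicentral

variable {X : Type*} {l : Filter X} {E : X → ProjTensorSq A} {k' e : X → A}

/-- With E = ∑ b ⊗ c and k = m(E), the element is ∑ b e c + (1 - k) e (1 - k'). The commutator of a
with the sum is the average of e over a·E - E·a; the other term is killed by a on both sides, since
a(1 - k) → 0 and (1 - k')a → 0. -/
theorem null_quasicentral_comm (hE : NormBdd l E) (hk' : NormBdd l k') (he : NormBdd l e) {a : A}
    (hc : Null l fun x => lact a (E x) - ract a (E x))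
    (h1 : Null l fun x => a * mulMap A (E x) - a) (h2 : Null l fun x => k' x * a - a) :
    Null l fun x =>
      a * (sandwich (e x) (E x) + ((e x - mulMap A (E x) * e x) -
        (e x - mulMap A (E x) * e x) * k' x)) -
      (sandwich (e x) (E x) + ((e x - mulMap A (E x) * e x) -
        (e x - mulMap A (E x) * e x) * k' x)) * a := by
  have hk := hE.clm (mulMap A)
  refine (((he.sandwich_null hc).sub (h1.mul_bdd (he.sub (he.mul hk')))).add
    ((he.sub (hk.mul he)).mul_null h2)).congr fun x => ?_
  simp only [map_sub, sandwich_lact, sandwich_ract, mul_sub, sub_mul, mul_add, add_mul, mul_assoc]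
  abel

/-- Letting e act as a unit turns ∑ b e c + (1 - k) e (1 - k') into k + (1 - k)(1 - k') = 1 - k' + k
k', and k k' → k'. -/
theorem null_quasicentral_mul (hE : NormBdd l E) {a : A}
    (hs : Null l fun x => sandwich (e x) (E x) * a - mulMap A (E x) * a)
    (hk : Null l fun x => mulMap A (E x) * k' x - k' x)
    (h : Null l fun x => e x * (a - k' x * a) - (a - k' x * a)) :
    Null l fun x => (sandwich (e x) (E x) + ((e x - mulMap A (E x) * e x) -
        (e x - mulMap A (E x) * e x) * k' x)) * a - a := by
  refine (((hs.add h).sub ((hE.clm (mulMap A)).mul_null h)).add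
    (hk.mul_bdd (NormBdd.const l a))).congr fun x => ?_
  simp only [mul_sub, sub_mul, add_mul, mul_assoc]
  abel

theorem null_mul_quasicentral (hk' : NormBdd l k') {a : A}
    (hs : Null l fun x => a * sandwich (e x) (E x) - a * mulMap A (E x))
    (hk : Null l fun x => mulMap A (E x) * k' x - k' x)
    (h : Null l fun x => (a - a * mulMap A (E x)) * e x - (a - a * mulMap A (E x))) :
    Null l fun x => a * (sandwich (e x) (E x) + ((e x - mulMap A (E x) * e x) -
        (e x - mulMap A (E x) * e x) * k' x)) - a := by
  refine (((hs.add h).sub (h.mul_bdd hk')).add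
    ((NormBdd.const l a).mul_null hk)).congr fun x => ?_
  simp only [mul_sub, sub_mul, mul_add, mul_assoc]
  abel

/-- The element averages e = m(D) over E + (1 - k) ⊗ (1 - k'), an approximate diagonal of the
unitization of C. The hypotheses `hk` to `he2` isolate what depends on the order in which the three
variables move. -/
theorem isQuasicentralUnit_map {I C : Submodule ℂ A} (hI : IsClosed (I : Set A))
    (hl : ∀ a : A, ∀ b ∈ I, a * b ∈ I) (hr : ∀ a ∈ I, ∀ b : A, a * b ∈ I)
    {lI lC : Filter (ProjTensorSq A)} (dI : IsApproxDiagFor I lI) (dC : IsApproxDiagFor C lC)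
    [l.NeBot] {E' D : X → ProjTensorSq A} (t1 : Tendsto E' l lC) (t2 : Tendsto E l lC)
    (t3 : Tendsto D l lI)
    (hk : Null l fun x => mulMap A (E x) * mulMap A (E' x) - mulMap A (E' x))
    (hs1 : ∀ a ∈ I, Null l fun x => a * sandwich (mulMap A (D x)) (E x) - a * mulMap A (E x))
    (hs2 : ∀ a ∈ I, Null l fun x => sandwich (mulMap A (D x)) (E x) * a - mulMap A (E x) * a)
    (he1 : ∀ a ∈ I, Null l fun x =>
      (a - a * mulMap A (E x)) * mulMap A (D x) - (a - a * mulMap A (E x)))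
    (he2 : ∀ a ∈ I, Null l fun x =>
      mulMap A (D x) * (a - mulMap A (E' x) * a) - (a - mulMap A (E' x) * a)) :
    IsQuasicentralUnit I C (map (fun x => sandwich (mulMap A (D x)) (E x) +
      ((mulMap A (D x) - mulMap A (E x) * mulMap A (D x)) -
        (mulMap A (D x) - mulMap A (E x) * mulMap A (D x)) * mulMap A (E' x))) l) := by
  have bE := dC.bdd.comp_tendsto t2
  have bk' := (dC.bdd.comp_tendsto t1).clm (mulMap A)
  have be := (dI.bdd.comp_tendsto t3).clm (mulMap A)
  have hg := be.sub ((bE.clm (mulMap A)).mul be)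
  refine ⟨inferInstance, ?_, ?_, ?_, ?_, ?_⟩
  · exact (be.sandwich bE).add (hg.sub (hg.mul bk'))
  · rw [eventually_map]
    filter_upwards [t3.eventually dI.mem] with x hx
    have h1 := I.sub_mem hx (hl (mulMap A (E x)) _ hx)
    refine I.add_mem ?_ (I.sub_mem h1 (hr _ h1 _))
    refine clm_mem _ I hI (fun b c => ?_) _
    rw [sandwich_tmul]
    exact hr _ (hl _ _ hx) _
  · exact fun a ha => null_mul_quasicentral bk' (hs1 a ha) hk (he1 a ha)
  · exact fun a ha => null_quasicentral_mul bE (hs2 a ha) hk (he2 a ha)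
  · exact fun a ha => null_quasicentral_comm bE bk' be ((dC.central a ha).comp_tendsto t2)
      ((dC.mul_mulMap a ha).comp_tendsto t2) ((dC.mulMap_mul a ha).comp_tendsto t1)

/-- If `I` is a closed ideal and both `I` and `C` have bounded approximate diagonals, then `I` has
a bounded approximate identity which asymptotically commutes with `C`: average an approximate
identity of `I` over an approximate diagonal of the unitization of `C`. -/
theorem exists_isQuasicentralUnit {I C : Submodule ℂ A} (hI : IsClosed (I : Set A))
    (hl : ∀ a : A, ∀ b ∈ I, a * b ∈ I) (hr : ∀ a ∈ I, ∀ b : A, a * b ∈ I)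
    {lI lC : Filter (ProjTensorSq A)} (dI : IsApproxDiagFor I lI) (dC : IsApproxDiagFor C lC) :
    ∃ l, IsQuasicentralUnit I C l := by
  have := dI.neBot
  have := dC.neBot
  have := neBot_curry lC lI
  have := neBot_curry lC (lC.curry lI)
  have s2 := tendsto_snd_curry lC (lC.curry lI)
  have be := dI.bdd.clm (mulMap A)
  -- E' is outermost, then E, then D: e converges with E and E' fixed, and k k' → k' with E' fixed.
  refine ⟨_, isQuasicentralUnit_map (l := lC.curry (lC.curry lI)) hI hl hr dI dC
    (tendsto_fst_curry _ _) ((tendsto_fst_curry _ _).comp s2) ((tendsto_snd_curry _ _).comp s2)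
    (Null.curry ?_) (fun a ha => Null.curry (.of_forall fun E' => Null.curry (.of_forall fun E => ?_)))
    (fun a ha => Null.curry (.of_forall fun E' => Null.curry (.of_forall fun E => ?_)))
    (fun a ha => Null.curry (.of_forall fun E' => Null.curry (.of_forall fun E => ?_)))
    (fun a ha => Null.curry (.of_forall fun E' => Null.curry (.of_forall fun E => ?_)))⟩
  -- k' = m(E') lies in C, so the approximate unit k of C applies to it.
  · filter_upwards [dC.mem] with E' hE'
    exact (dC.mulMap_mul _ hE').comp_tendsto (tendsto_fst_curry _ _)
  · exact null_mul_sandwich be hr dI.mul_mulMap ha E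
  · exact null_sandwich_mul be hl dI.mulMap_mul ha E
  · exact dI.mul_mulMap (a - a * mulMap A E) (I.sub_mem ha (hr _ ha _))
  · exact dI.mulMap_mul (a - mulMap A E' * a) (I.sub_mem ha (hl _ _ ha))

end Quasicentral

/-! ### Gluing approximate diagonals of an ideal and of a complement -/

section Glue

variable {X : Type*} {l : Filter X} {f' f : X → A} {D E : X → ProjTensorSq A}

/-- The element `f · D + (1 - f) · E · (1 - f')`. -/
noncomputable def glue (f' f : A) (D E : ProjTensorSq A) : ProjTensorSq A :=
  lact f D + ((E - lact f E) - ract f' (E - lact f E))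

theorem mulMap_glue (f' f : A) (D E : ProjTensorSq A) :
    mulMap A (glue f' f D E) = f * mulMap A D +
      ((mulMap A E - f * mulMap A E) - (mulMap A E - f * mulMap A E) * f') := by
  simp [glue, mulMap_lact, mulMap_ract, sub_mul]

omit [CompleteSpace A] in
theorem NormBdd.glue (hf' : NormBdd l f') (hf : NormBdd l f) (hD : NormBdd l D)
    (hE : NormBdd l E) : NormBdd l fun x => glue (f' x) (f x) (D x) (E x) :=
  (hf.lact hD).add ((hE.sub (hf.lact hE)).sub (hf'.ract (hE.sub (hf.lact hE))))

/-- For a in the ideal, a(1 - f) → 0 removes the E-term, and a f m(D) ≈ a f ≈ a. -/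
theorem null_mul_mulMap_glue_of_mem_ideal (hf' : NormBdd l f') (hE : NormBdd l E) {a : A}
    (hfD : Null l fun x => f x * mulMap A (D x) - f x) (ha : Null l fun x => a * f x - a) :
    Null l fun x => a * mulMap A (glue (f' x) (f x) (D x) (E x)) - a := by
  have hk := hE.clm (mulMap A)
  refine ((((NormBdd.const l a).mul_null hfD).add ha).sub
    (ha.mul_bdd (hk.sub (hk.mul hf')))).congr fun x => ?_
  simp only [mulMap_glue, mul_sub, sub_mul, mul_add, mul_assoc]
  abel

theorem null_mulMap_glue_mul_of_mem_ideal (hf : NormBdd l f) (hE : NormBdd l E) {a : A}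
    (hfD : Null l fun x => f x * mulMap A (D x) - f x) (ha : Null l fun x => f x * a - a)
    (ha' : Null l fun x => f' x * a - a) :
    Null l fun x => mulMap A (glue (f' x) (f x) (D x) (E x)) * a - a := by
  have hk := hE.clm (mulMap A)
  refine (((hfD.mul_bdd (NormBdd.const l a)).add ha).sub
    ((hk.sub (hf.mul hk)).mul_null ha')).congr fun x => ?_
  simp only [mulMap_glue, mul_sub, sub_mul, add_mul, mul_assoc]
  abel

/-- Commuting a past f gives a f m(D) ≈ a f and a(1 - f)m(E)(1 - f') ≈ (1 - f)a(1 - f') ≈ a(1 - f)(1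
- f'). The sum tends to a because f f' ≈ f'. -/
theorem null_mul_mulMap_glue (hf' : NormBdd l f') (hf : NormBdd l f) (hE : NormBdd l E) {a : A}
    (hfD : Null l fun x => f x * mulMap A (D x) - f x) (hff : Null l fun x => f x * f' x - f' x)
    (ha : Null l fun x => a * f x - f x * a) (hE1 : Null l fun x => a * mulMap A (E x) - a) :
    Null l fun x => a * mulMap A (glue (f' x) (f x) (D x) (E x)) - a := by
  have hk := hE.clm (mulMap A)
  have hq := hE1.sub (hE1.mul_bdd hf')
  refine (((((((NormBdd.const l a).mul_null hfD).sub (ha.mul_bdd (hk.sub (hk.mul hf')))).add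
    hq).sub (hf.mul_null hq)).add (ha.sub (ha.mul_bdd hf'))).add
      ((NormBdd.const l a).mul_null hff)).congr fun x => ?_
  simp only [mulMap_glue, mul_sub, sub_mul, mul_add, mul_assoc]
  abel

theorem null_mulMap_glue_mul (hf' : NormBdd l f') (hf : NormBdd l f) (hE : NormBdd l E) {a : A}
    (hfD : Null l fun x => f x * mulMap A (D x) - f x) (hff : Null l fun x => f x * f' x - f' x)
    (ha : Null l fun x => a * f x - f x * a) (ha' : Null l fun x => a * f' x - f' x * a)
    (hE2 : Null l fun x => mulMap A (E x) * a - a) :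
    Null l fun x => mulMap A (glue (f' x) (f x) (D x) (E x)) * a - a := by
  have hk := hE.clm (mulMap A)
  have hq := hE2.sub (hf.mul_null hE2)
  refine ((((((hfD.mul_bdd (NormBdd.const l a)).add ((hk.sub (hf.mul hk)).mul_null ha')).add
    hq).sub (hq.mul_bdd hf')).sub (ha.mul_bdd hf')).add
      ((NormBdd.const l a).mul_null hff)).congr fun x => ?_
  simp only [mulMap_glue, mul_sub, sub_mul, add_mul, mul_assoc]
  abel

omit [CompleteSpace A] in
-- D is only known to be central for the ideal, but f a lies there for every a in the application: a
-- f·D ≈ f a·D ≈ D·f a ≈ (f·D)·a.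
theorem null_central_lact (hD : NormBdd l D) {a : A}
    (h1 : Null l fun x => lact (f x) (D x) - ract (f x) (D x))
    (h2 : Null l fun x => lact (f x * a) (D x) - ract (f x * a) (D x))
    (ha : Null l fun x => a * f x - f x * a) :
    Null l fun x => lact a (lact (f x) (D x)) - ract a (lact (f x) (D x)) := by
  refine (((ha.lact hD).add h2).sub ((NormBdd.const l a).ract_null h1)).congr fun x => ?_
  simp only [lact_sub, lact_mul, ract_mul, map_sub]
  abel

omit [CompleteSpace A] in
-- Both a(1 - f) and (1 - f')a tend to zero, so the E-part vanishes under either action of a.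
theorem null_central_glue_of_mem_ideal (hf' : NormBdd l f') (hf : NormBdd l f) (hE : NormBdd l E)
    {a : A} (hD : Null l fun x => lact a (lact (f x) (D x)) - ract a (lact (f x) (D x)))
    (ha : Null l fun x => a * f x - a) (ha' : Null l fun x => f' x * a - a) :
    Null l fun x => lact a (glue (f' x) (f x) (D x) (E x)) -
      ract a (glue (f' x) (f x) (D x) (E x)) := by
  have h1 := ha.lact hE
  have h2 := ha'.ract (hE.sub (hf.lact hE))
  refine (((hD.sub h1).add (hf'.ract_null h1)).add h2).congr fun x => ?_
  simp only [glue, lact_sub, lact_mul, ract_sub, ract_mul, map_sub, map_add, ract_lact]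
  abel

omit [CompleteSpace A] in
theorem null_central_glue (hf' : NormBdd l f') (hf : NormBdd l f) (hE : NormBdd l E)
    {a : A} (hD : Null l fun x => lact a (lact (f x) (D x)) - ract a (lact (f x) (D x)))
    (ha : Null l fun x => a * f x - f x * a) (ha' : Null l fun x => a * f' x - f' x * a)
    (hc : Null l fun x => lact a (E x) - ract a (E x)) :
    Null l fun x => lact a (glue (f' x) (f x) (D x) (E x)) -
      ract a (glue (f' x) (f x) (D x) (E x)) := by
  have hV := (hc.sub (hf.lact_null hc)).sub (ha.lact hE)
  refine (((hD.add hV).sub (hf'.ract_null hV)).sub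
    (ha'.ract (hE.sub (hf.lact hE)))).congr fun x => ?_
  simp only [glue, lact_sub, lact_mul, ract_sub, ract_mul, map_sub, map_add, ract_lact]
  abel

theorem isApproxDiagFor_map_glue {I C : Submodule ℂ A}
    (hl : ∀ a : A, ∀ b ∈ I, a * b ∈ I) (hr : ∀ a ∈ I, ∀ b : A, a * b ∈ I)
    {lI lC : Filter (ProjTensorSq A)} {q : Filter A} (dI : IsApproxDiagFor I lI)
    (dC : IsApproxDiagFor C lC) (hq : IsQuasicentralUnit I C q) [l.NeBot]
    (t1 : Tendsto f' l q) (t2 : Tendsto f l q) (t3 : Tendsto D l lI) (t4 : Tendsto E l lC)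
    (hff : Null l fun x => f x * f' x - f' x)
    (hfD : Null l fun x => f x * mulMap A (D x) - f x)
    (hfDc : Null l fun x => lact (f x) (D x) - ract (f x) (D x))
    (hfDa : ∀ a : A, Null l fun x => lact (f x * a) (D x) - ract (f x * a) (D x)) :
    IsApproxDiagFor (I ⊔ C) (map (fun x => glue (f' x) (f x) (D x) (E x)) l) := by
  have bf' := hq.bdd.comp_tendsto t1
  have bf := hq.bdd.comp_tendsto t2
  have bD := dI.bdd.comp_tendsto t3
  have bE := dC.bdd.comp_tendsto t4
  refine ⟨inferInstance, NormBdd.glue bf' bf bD bE, ?_, ?_, ?_, ?_⟩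
  · rw [eventually_map]
    filter_upwards [t2.eventually hq.mem, t1.eventually hq.mem, t4.eventually dC.mem]
      with x hf hf' hE
    simp only [mulMap_glue]
    -- Every term of m(glue) other than m(E) has a factor f or f', hence lies in I.
    have : f x * mulMap A (D x) - f x * mulMap A (E x) -
        (mulMap A (E x) - f x * mulMap A (E x)) * f' x ∈ I :=
      I.sub_mem (I.sub_mem (hr _ hf _) (hr _ hf _)) (hl _ _ hf')
    convert! (I ⊔ C).add_mem (Submodule.mem_sup_left this) (Submodule.mem_sup_right hE) using 1
    abel
  · intro a ha
    obtain ⟨y, hy, c, hc, rfl⟩ := Submodule.mem_sup.1 ha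
    have h1 := null_mul_mulMap_glue_of_mem_ideal bf' bE hfD ((hq.mul_unit y hy).comp_tendsto t2)
    have h2 := null_mul_mulMap_glue bf' bf bE hfD hff ((hq.comm c hc).comp_tendsto t2)
      ((dC.mul_mulMap c hc).comp_tendsto t4)
    exact Null.map ((h1.add h2).congr fun x => by simp only [add_mul]; abel)
  · intro a ha
    obtain ⟨y, hy, c, hc, rfl⟩ := Submodule.mem_sup.1 ha
    have h1 := null_mulMap_glue_mul_of_mem_ideal bf bE hfD ((hq.unit_mul y hy).comp_tendsto t2)
      ((hq.unit_mul y hy).comp_tendsto t1)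
    have h2 := null_mulMap_glue_mul bf' bf bE hfD hff ((hq.comm c hc).comp_tendsto t2)
      ((hq.comm c hc).comp_tendsto t1) ((dC.mulMap_mul c hc).comp_tendsto t4)
    exact Null.map ((h1.add h2).congr fun x => by simp only [mul_add]; abel)
  · intro a ha
    obtain ⟨y, hy, c, hc, rfl⟩ := Submodule.mem_sup.1 ha
    have hy' : Null l fun x => y * f x - f x * y :=
      (((hq.mul_unit y hy).sub (hq.unit_mul y hy)).comp_tendsto t2).congr fun x => by abel
    have hc' := (hq.comm c hc).comp_tendsto t2
    have h1 := null_central_glue_of_mem_ideal bf' bf bE (null_central_lact bD hfDc (hfDa y) hy')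
      ((hq.mul_unit y hy).comp_tendsto t2) ((hq.unit_mul y hy).comp_tendsto t1)
    have h2 := null_central_glue bf' bf bE (null_central_lact bD hfDc (hfDa c) hc')
      hc' ((hq.comm c hc).comp_tendsto t1) ((dC.central c hc).comp_tendsto t4)
    exact Null.map ((h1.add h2).congr fun x => by simp only [lact_add, ract_add]; abel)

/-- Bounded approximate diagonals for a closed ideal `I` and for a subspace `C` can be glued to one
for `I + C`. -/
theorem exists_isApproxDiagFor_sup {I C : Submodule ℂ A} (hI : IsClosed (I : Set A))
    (hl : ∀ a : A, ∀ b ∈ I, a * b ∈ I) (hr : ∀ a ∈ I, ∀ b : A, a * b ∈ I)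
    {lI lC : Filter (ProjTensorSq A)} (dI : IsApproxDiagFor I lI) (dC : IsApproxDiagFor C lC) :
    ∃ l, IsApproxDiagFor (I ⊔ C) l := by
  obtain ⟨q, hq⟩ := exists_isQuasicentralUnit hI hl hr dI dC
  have := dI.neBot
  have := dC.neBot
  have := hq.neBot
  have := neBot_curry q (lI ×ˢ lC)
  have := neBot_curry q (q.curry (lI ×ˢ lC))
  have s2 := tendsto_snd_curry q (q.curry (lI ×ˢ lC))
  have s3 := (tendsto_snd_curry q (lI ×ˢ lC)).comp s2
  -- f' is outermost, then f, then the pair (D, E): D may be adapted to f and to f a, and f to f'.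
  refine ⟨_, isApproxDiagFor_map_glue (l := q.curry (q.curry (lI ×ˢ lC))) hl hr dI dC hq
    (tendsto_fst_curry _ _) ((tendsto_fst_curry _ _).comp s2) (tendsto_fst.comp s3)
    (tendsto_snd.comp s3) (Null.curry ?_)
    (Null.curry (.of_forall fun f' => Null.curry ?_))
    (Null.curry (.of_forall fun f' => Null.curry ?_))
    (fun a => Null.curry (.of_forall fun f' => Null.curry ?_))⟩
  all_goals filter_upwards [hq.mem] with f hf
  · exact (hq.unit_mul _ hf).comp_tendsto (tendsto_fst_curry _ _)
  · exact (dI.mul_mulMap _ hf).comp_tendsto tendsto_fst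
  · exact (dI.central _ hf).comp_tendsto tendsto_fst
  · exact (dI.central _ (hr _ hf _)).comp_tendsto tendsto_fst

end Glue

end Extension

set_option linter.unusedSectionVars false

/-! ### Amenability of complemented ideals of retracts -/

section Retract

variable {A B : Type u} [NonUnitalNormedRing A] [NormedSpace ℂ A]
  [IsScalarTower ℂ A A] [SMulCommClass ℂ A A]
  [NonUnitalNormedRing B] [NormedSpace ℂ B]

open ProjTensorSq

/-- `j` embeds `B` isometrically as a subalgebra of `A`, `Q` is a bounded endomorphism of `A` which
fixes `B` and has `B` as an ideal of its range, and `P` is a bounded projection of `A` onto `B`. -/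
structure IsComplementedIdealOfRetract (j : B →L[ℂ] A) (P : A →L[ℂ] B) (Q : A →L[ℂ] A) :
    Prop where
  norm_map : ∀ x, ‖j x‖ = ‖x‖
  map_mul : ∀ x y, j (x * y) = j x * j y
  proj_apply : ∀ x, P (j x) = x
  hom_mul : ∀ a b, Q (a * b) = Q a * Q b
  hom_apply : ∀ x, Q (j x) = j x
  mul_mem : ∀ a x, j (P (Q a * j x)) = Q a * j x
  mem_mul : ∀ a x, j (P (j x * Q a)) = j x * Q a

variable {j : B →L[ℂ] A} {P : A →L[ℂ] B} {Q : A →L[ℂ] A}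

/-- The map `b ↦ P (j e * Q b)`. -/
noncomputable def compressLeft (j : B →L[ℂ] A) (P : A →L[ℂ] B) (Q : A →L[ℂ] A) (e : B) :
    A →L[ℂ] B :=
  (P.comp (ContinuousLinearMap.mul ℂ A (j e))).comp Q

/-- The map `c ↦ P (Q c * j e)`. -/
noncomputable def compressRight (j : B →L[ℂ] A) (P : A →L[ℂ] B) (Q : A →L[ℂ] A) (e : B) :
    A →L[ℂ] B :=
  (P.comp ((ContinuousLinearMap.mul ℂ A).flip (j e))).comp Q

theorem compressLeft_apply (e : B) (b : A) : compressLeft j P Q e b = P (j e * Q b) := rfl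

theorem compressRight_apply (e : B) (c : A) : compressRight j P Q e c = P (Q c * j e) := rfl

theorem compressLeft_sub (e e' : B) :
    compressLeft j P Q (e - e') = compressLeft j P Q e - compressLeft j P Q e' := by
  ext b; simp [compressLeft_apply, sub_mul]

theorem compressRight_sub (e e' : B) :
    compressRight j P Q (e - e') = compressRight j P Q e - compressRight j P Q e' := by
  ext b; simp [compressRight_apply, mul_sub]

/-- The average `∑ P (Q b) * Q c` of `D = ∑ b ⊗ c`, a left approximate unit. -/
noncomputable def leftUnit [CompleteSpace A] (j : B →L[ℂ] A) (P : A →L[ℂ] B) (Q : A →L[ℂ] A) :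
    ProjTensorSq A →L[ℂ] A :=
  (mulMap A).comp (mapSq (j.comp (P.comp Q)) Q)

/-- The average `∑ Q b * P (Q c)` of `D = ∑ b ⊗ c`, a right approximate unit. -/
noncomputable def rightUnit [CompleteSpace A] (j : B →L[ℂ] A) (P : A →L[ℂ] B) (Q : A →L[ℂ] A) :
    ProjTensorSq A →L[ℂ] A :=
  (mulMap A).comp (mapSq Q (j.comp (P.comp Q)))

/-- The element `u + v - v * u` formed from a left approximate unit `u` and a right one `v`. -/
noncomputable def twoSidedUnit [CompleteSpace A] (j : B →L[ℂ] A) (P : A →L[ℂ] B) (Q : A →L[ℂ] A)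
    (D : ProjTensorSq A) : B :=
  P (leftUnit j P Q D) + P (rightUnit j P Q D) - P (rightUnit j P Q D) * P (leftUnit j P Q D)

/-- The compression of `D` to `B`: the tensor `∑ P (j e * Q b) ⊗ P (Q c * j e)`, where `e` is the
approximate unit of `B` formed from `D = ∑ b ⊗ c`. -/
noncomputable def compress [CompleteSpace A] (j : B →L[ℂ] A) (P : A →L[ℂ] B) (Q : A →L[ℂ] A)
    (D : ProjTensorSq A) : ProjTensorSq B :=
  mapSq (compressLeft j P Q (twoSidedUnit j P Q D)) (compressRight j P Q (twoSidedUnit j P Q D)) D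

theorem norm_compressLeft_le (e : B) :
    ‖compressLeft j P Q e‖ ≤ ‖P‖ * ‖j‖ * ‖Q‖ * ‖e‖ := by
  refine ContinuousLinearMap.opNorm_le_bound _ (by positivity) fun b => ?_
  calc ‖P (j e * Q b)‖ ≤ ‖P‖ * (‖j e‖ * ‖Q b‖) :=
        (P.le_opNorm _).trans (by gcongr; exact norm_mul_le _ _)
    _ ≤ ‖P‖ * ((‖j‖ * ‖e‖) * (‖Q‖ * ‖b‖)) := by
        gcongr
        · exact j.le_opNorm _
        · exact Q.le_opNorm _
    _ = _ := by ring

theorem norm_compressRight_le (e : B) :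
    ‖compressRight j P Q e‖ ≤ ‖P‖ * ‖j‖ * ‖Q‖ * ‖e‖ := by
  refine ContinuousLinearMap.opNorm_le_bound _ (by positivity) fun b => ?_
  calc ‖P (Q b * j e)‖ ≤ ‖P‖ * (‖Q b‖ * ‖j e‖) :=
        (P.le_opNorm _).trans (by gcongr; exact norm_mul_le _ _)
    _ ≤ ‖P‖ * ((‖Q‖ * ‖b‖) * (‖j‖ * ‖e‖)) := by
        gcongr
        · exact Q.le_opNorm _
        · exact j.le_opNorm _
    _ = _ := by ring

theorem norm_mapSq_compress_le (e e' : B) (D : ProjTensorSq A) :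
    ‖mapSq (compressLeft j P Q e) (compressRight j P Q e') D‖ ≤
      (‖P‖ * ‖j‖ * ‖Q‖) ^ 2 * (‖e‖ * ‖e'‖ * ‖D‖) := by
  refine (norm_mapSq_apply_le _ _ _).trans ?_
  calc _ ≤ (‖P‖ * ‖j‖ * ‖Q‖ * ‖e‖) * (‖P‖ * ‖j‖ * ‖Q‖ * ‖e'‖) * ‖D‖ := by
        gcongr
        · exact norm_compressLeft_le e
        · exact norm_compressRight_le e'
    _ = _ := by ring

namespace IsComplementedIdealOfRetract

section

variable (h : IsComplementedIdealOfRetract j P Q)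
include h

theorem injective : Function.Injective j := fun x y hxy => by
  rw [← h.proj_apply x, hxy, h.proj_apply]

theorem null_of_map {X : Type*} {l : Filter X} {w : X → B} (hw : Null l fun x => j (w x)) :
    Null l w := by
  rw [Null, tendsto_zero_iff_norm_tendsto_zero] at hw ⊢
  simpa [h.norm_map] using hw

/-- P is not assumed to be a module map. Here j e * Q b already lies in the ideal j(B), so P merely
reads it as an element of B. -/
theorem compressLeft_mul (x e : B) (b : A) :
    compressLeft j P Q (x * e) b = x * compressLeft j P Q e b := by
  apply h.injective
  simp only [compressLeft_apply, h.mem_mul, h.map_mul, mul_assoc]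
  rw [← mul_assoc, ← h.map_mul, h.mem_mul, h.map_mul, mul_assoc]

theorem compressRight_mul (x e : B) (c : A) :
    compressRight j P Q (e * x) c = compressRight j P Q e c * x := by
  apply h.injective
  simp only [compressRight_apply, h.mul_mem, h.map_mul, mul_assoc]
  rw [← h.map_mul, h.mul_mem]

theorem compressLeft_map_mul (x e : B) (b : A) :
    compressLeft j P Q e (j x * b) = compressLeft j P Q (e * x) b := by
  simp [compressLeft_apply, h.hom_mul, h.hom_apply, h.map_mul, mul_assoc]

theorem compressRight_mul_map (x e : B) (c : A) :
    compressRight j P Q e (c * j x) = compressRight j P Q (x * e) c := by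
  simp [compressRight_apply, h.hom_mul, h.hom_apply, h.map_mul, mul_assoc]

end

variable [IsScalarTower ℂ B B] [SMulCommClass ℂ B B] [CompleteSpace A]

section

variable (h : IsComplementedIdealOfRetract j P Q)
include h

theorem lact_mapSq (x e : B) (T : A →L[ℂ] B) (D : ProjTensorSq A) :
    lact x (mapSq (compressLeft j P Q e) T D) = mapSq (compressLeft j P Q (x * e)) T D := by
  have : (lact x).comp (mapSq (compressLeft j P Q e) T) =
      mapSq (compressLeft j P Q (x * e)) T :=
    clm_ext fun b c => by simp [mapSq_tmul, lact_tmul, h.compressLeft_mul]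
  exact congr($this D)

theorem ract_mapSq (x e : B) (T : A →L[ℂ] B) (D : ProjTensorSq A) :
    ract x (mapSq T (compressRight j P Q e) D) = mapSq T (compressRight j P Q (e * x)) D := by
  have : (ract x).comp (mapSq T (compressRight j P Q e)) =
      mapSq T (compressRight j P Q (e * x)) :=
    clm_ext fun b c => by simp [mapSq_tmul, ract_tmul, h.compressRight_mul]
  exact congr($this D)

theorem mapSq_lact (x e : B) (T : A →L[ℂ] B) (D : ProjTensorSq A) :
    mapSq (compressLeft j P Q e) T (lact (j x) D) = mapSq (compressLeft j P Q (e * x)) T D := by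
  have : (mapSq (compressLeft j P Q e) T).comp (lact (j x)) =
      mapSq (compressLeft j P Q (e * x)) T :=
    clm_ext fun b c => by simp [mapSq_tmul, lact_tmul, h.compressLeft_map_mul]
  exact congr($this D)

theorem mapSq_ract (x e : B) (T : A →L[ℂ] B) (D : ProjTensorSq A) :
    mapSq T (compressRight j P Q e) (ract (j x) D) = mapSq T (compressRight j P Q (x * e)) D := by
  have : (mapSq T (compressRight j P Q e)).comp (ract (j x)) =
      mapSq T (compressRight j P Q (x * e)) :=
    clm_ext fun b c => by simp [mapSq_tmul, ract_tmul, h.compressRight_mul_map]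
  exact congr($this D)

theorem map_mulMap [CompleteSpace B] (e e' : B) (D : ProjTensorSq A) :
    j (mulMap B (mapSq (compressLeft j P Q e) (compressRight j P Q e') D)) =
      j e * Q (mulMap A D) * j e' := by
  have : (j.comp (mulMap B)).comp (mapSq (compressLeft j P Q e) (compressRight j P Q e')) =
      (((ContinuousLinearMap.mul ℂ A).flip (j e')).comp
        ((ContinuousLinearMap.mul ℂ A (j e)).comp Q)).comp (mulMap A) :=
    clm_ext fun b c => by
      simp [mapSq_tmul, mulMap_tmul, h.map_mul, compressLeft_apply, compressRight_apply, h.mem_mul,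
        h.mul_mem, h.hom_mul, mul_assoc]
  exact congr($this D)

theorem map_proj_leftUnit (D : ProjTensorSq A) :
    j (P (leftUnit j P Q D)) = leftUnit j P Q D := by
  have : (j.comp P).comp (leftUnit j P Q) = leftUnit j P Q :=
    clm_ext fun b c => by simp [leftUnit, mapSq_tmul, mulMap_tmul, h.mem_mul]
  exact congr($this D)

theorem map_proj_rightUnit (D : ProjTensorSq A) :
    j (P (rightUnit j P Q D)) = rightUnit j P Q D := by
  have : (j.comp P).comp (rightUnit j P Q) = rightUnit j P Q :=
    clm_ext fun b c => by simp [rightUnit, mapSq_tmul, mulMap_tmul, h.mul_mem]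
  exact congr($this D)

theorem leftUnit_ract (x : B) (D : ProjTensorSq A) :
    leftUnit j P Q (ract (j x) D) = leftUnit j P Q D * j x := by
  have : (leftUnit j P Q).comp (ract (j x)) =
      ((ContinuousLinearMap.mul ℂ A).flip (j x)).comp (leftUnit j P Q) :=
    clm_ext fun b c => by
      simp [leftUnit, mapSq_tmul, mulMap_tmul, ract_tmul, h.hom_mul, h.hom_apply, mul_assoc]
  exact congr($this D)

/-- Once x multiplies from the left, the first factor is already in the ideal, so P disappears and
the average collapses to a product. -/
theorem leftUnit_lact (x : B) (D : ProjTensorSq A) :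
    leftUnit j P Q (lact (j x) D) = Q (j x * mulMap A D) := by
  have : (leftUnit j P Q).comp (lact (j x)) =
      (Q.comp (ContinuousLinearMap.mul ℂ A (j x))).comp (mulMap A) :=
    clm_ext fun b c => by
      simp [leftUnit, mapSq_tmul, mulMap_tmul, lact_tmul, h.hom_mul, h.hom_apply, h.mem_mul,
        mul_assoc]
  exact congr($this D)

theorem rightUnit_lact (x : B) (D : ProjTensorSq A) :
    rightUnit j P Q (lact (j x) D) = j x * rightUnit j P Q D := by
  have : (rightUnit j P Q).comp (lact (j x)) =
      (ContinuousLinearMap.mul ℂ A (j x)).comp (rightUnit j P Q) :=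
    clm_ext fun b c => by
      simp [rightUnit, mapSq_tmul, mulMap_tmul, lact_tmul, h.hom_mul, h.hom_apply, mul_assoc]
  exact congr($this D)

theorem rightUnit_ract (x : B) (D : ProjTensorSq A) :
    rightUnit j P Q (ract (j x) D) = Q (mulMap A D * j x) := by
  have : (rightUnit j P Q).comp (ract (j x)) =
      (Q.comp ((ContinuousLinearMap.mul ℂ A).flip (j x))).comp (mulMap A) :=
    clm_ext fun b c => by
      simp [rightUnit, mapSq_tmul, mulMap_tmul, ract_tmul, h.hom_mul, h.hom_apply, h.mul_mem,
        mul_assoc]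
  exact congr($this D)

end

section

variable {X : Type*} {l : Filter X} {D : X → ProjTensorSq A}

theorem normBdd_twoSidedUnit (hD : NormBdd l D) :
    NormBdd l fun i => twoSidedUnit j P Q (D i) := by
  have hu := (hD.clm (leftUnit j P Q)).clm P
  have hv := (hD.clm (rightUnit j P Q)).clm P
  exact (hu.add hv).sub (hv.mul hu)

theorem normBdd_mapSq_compress {e e' : X → B} (he : NormBdd l e) (he' : NormBdd l e')
    (hD : NormBdd l D) :
    NormBdd l fun i => mapSq (compressLeft j P Q (e i)) (compressRight j P Q (e' i)) (D i) :=
  (he.of_le_mul he' 1 (w := fun i => ‖e i‖ * ‖e' i‖) fun i => by simp).of_le_mul hD _ fun i => by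
    simpa using norm_mapSq_compress_le (e i) (e' i) (D i)

theorem null_mapSq_compress_left {e e' : X → B} (he : Null l e) (he' : NormBdd l e')
    (hD : NormBdd l D) :
    Null l fun i => mapSq (compressLeft j P Q (e i)) (compressRight j P Q (e' i)) (D i) :=
  (he.of_le_mul he' 1 (w := fun i => ‖e i‖ * ‖e' i‖) fun i => by simp).of_le_mul hD _ fun i => by
    simpa using norm_mapSq_compress_le (e i) (e' i) (D i)

theorem null_mapSq_compress_right {e e' : X → B} (he : NormBdd l e) (he' : Null l e')
    (hD : NormBdd l D) :
    Null l fun i => mapSq (compressLeft j P Q (e i)) (compressRight j P Q (e' i)) (D i) :=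
  (he'.of_le_mul he 1 (w := fun i => ‖e i‖ * ‖e' i‖) fun i => by simp [mul_comm]).of_le_mul hD _
    fun i => by simpa using norm_mapSq_compress_le (e i) (e' i) (D i)

theorem null_mapSq_compress {e e' : X → B} (he : NormBdd l e) (he' : NormBdd l e')
    (hD : Null l D) :
    Null l fun i => mapSq (compressLeft j P Q (e i)) (compressRight j P Q (e' i)) (D i) :=
  hD.of_le_mul (he.of_le_mul he' 1 (w := fun i => ‖e i‖ * ‖e' i‖) fun i => by simp)
    ((‖P‖ * ‖j‖ * ‖Q‖) ^ 2) fun i => by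
    simpa [mul_comm ‖D i‖] using norm_mapSq_compress_le (P := P) (Q := Q) (j := j) (e i) (e' i) (D i)

variable (h : IsComplementedIdealOfRetract j P Q) (hD : NormBdd l D)
include h hD

/-- For the left unit u: u(D)x = u(D·x) ≈ u(x·D) = Q(x m(D)) ≈ x. Then (u + v - vu)x - x = (ux - x)
- v(ux - x). -/
theorem null_twoSidedUnit_mul {x : B} (hc : Null l fun i => lact (j x) (D i) - ract (j x) (D i))
    (hm : Null l fun i => j x * mulMap A (D i) - j x) :
    Null l fun i => twoSidedUnit j P Q (D i) * x - x := by
  have hu : Null l fun i => P (leftUnit j P Q (D i)) * x - x := by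
    refine h.null_of_map (((hm.clm Q).sub (hc.clm (leftUnit j P Q))).congr fun i => ?_)
    simp only [map_sub, h.map_mul, h.map_proj_leftUnit, h.leftUnit_lact, h.leftUnit_ract,
      h.hom_apply]
    abel
  refine (hu.sub (((hD.clm (rightUnit j P Q)).clm P).mul_null hu)).congr fun i => ?_
  simp only [twoSidedUnit, mul_sub, sub_mul, add_mul, mul_assoc]
  abel

theorem null_mul_twoSidedUnit {x : B} (hc : Null l fun i => lact (j x) (D i) - ract (j x) (D i))
    (hm : Null l fun i => mulMap A (D i) * j x - j x) :
    Null l fun i => x * twoSidedUnit j P Q (D i) - x := by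
  have hv : Null l fun i => x * P (rightUnit j P Q (D i)) - x := by
    refine h.null_of_map (((hm.clm Q).add (hc.clm (rightUnit j P Q))).congr fun i => ?_)
    simp only [map_sub, h.map_mul, h.map_proj_rightUnit, h.rightUnit_lact, h.rightUnit_ract,
      h.hom_apply]
    abel
  refine (hv.sub (hv.mul_bdd ((hD.clm (leftUnit j P Q)).clm P))).congr fun i => ?_
  simp only [twoSidedUnit, mul_sub, sub_mul, mul_add, mul_assoc]
  abel

/-- Write L ⊗ R for the compression, with L and R carrying e. Acting by x puts xe into L or ex into
R. Replacing these by ex and xe costs the null commutator xe - ex, and what remains is the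
compression of x·D - D·x. -/
theorem null_central_compress {x : B} (hc : Null l fun i => lact (j x) (D i) - ract (j x) (D i))
    (hl : Null l fun i => x * twoSidedUnit j P Q (D i) - x)
    (hr : Null l fun i => twoSidedUnit j P Q (D i) * x - x) :
    Null l fun i => lact x (compress j P Q (D i)) - ract x (compress j P Q (D i)) := by
  have he := normBdd_twoSidedUnit (j := j) (P := P) (Q := Q) hD
  have hw := hl.sub hr
  refine (((null_mapSq_compress_left (j := j) (P := P) (Q := Q) hw he hD).add
    (null_mapSq_compress (j := j) (P := P) (Q := Q) he he hc)).add
    (null_mapSq_compress_right (j := j) (P := P) (Q := Q) he hw hD)).congr fun i => ?_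
  simp only [compress, h.lact_mapSq, h.ract_mapSq, map_sub, h.mapSq_lact, h.mapSq_ract,
    compressLeft_sub, compressRight_sub, mapSq_sub_left, mapSq_sub_right]
  abel

variable [CompleteSpace B]

theorem null_mul_mulMap_compress {x : B} (hm : Null l fun i => j x * mulMap A (D i) - j x)
    (hl : Null l fun i => x * twoSidedUnit j P Q (D i) - x) :
    Null l fun i => x * mulMap B (compress j P Q (D i)) - x := by
  have he := (normBdd_twoSidedUnit (j := j) (P := P) (Q := Q) hD).clm j
  have hk := (hD.clm (mulMap A)).clm Q
  have hl' := hl.clm j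
  refine h.null_of_map ((((hl'.mul_bdd (hk.mul he)).add ((hm.clm Q).mul_bdd he)).add hl').congr
    fun i => ?_)
  simp only [compress, h.map_mul, h.map_mulMap, map_sub, h.hom_mul, h.hom_apply, sub_mul, mul_assoc]
  abel

theorem null_mulMap_compress_mul {x : B} (hm : Null l fun i => mulMap A (D i) * j x - j x)
    (hr : Null l fun i => twoSidedUnit j P Q (D i) * x - x) :
    Null l fun i => mulMap B (compress j P Q (D i)) * x - x := by
  have he := (normBdd_twoSidedUnit (j := j) (P := P) (Q := Q) hD).clm j
  have hk := (hD.clm (mulMap A)).clm Q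
  have hr' := hr.clm j
  refine h.null_of_map (((((he.mul hk).mul_null hr').add (he.mul_null (hm.clm Q))).add hr').congr
    fun i => ?_)
  simp only [compress, h.map_mul, h.map_mulMap, map_sub, h.hom_mul, h.hom_apply, mul_sub, mul_assoc]
  abel

end

/-- Amenability passes from `A` to a complemented closed ideal of a retract of `A`. -/
theorem isAmenable [CompleteSpace B] (h : IsComplementedIdealOfRetract j P Q)
    (hA : IsAmenable A) : IsAmenable B := by
  obtain ⟨ι, _, _, _, D, hD⟩ := hA
  obtain ⟨C, hC⟩ := hD.bounded
  -- Along `⊤` the bound holds at every index, as the definition of a bounded approximate diagonal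
  -- demands; along `atTop` it would hold only eventually.
  have hb : NormBdd ⊤ D := ⟨C, .of_forall hC⟩
  have hb' : NormBdd atTop D := ⟨C, .of_forall hC⟩
  have he := normBdd_twoSidedUnit (j := j) (P := P) (Q := Q) hb
  have h1 (x : B) : Null atTop fun i => j x * mulMap A (D i) - j x := by
    simpa [Null] using (hD.mul_mulMap (j x)).sub_const (j x)
  have h2 (x : B) : Null atTop fun i => mulMap A (D i) * j x - j x := by
    simpa [Null] using (hD.mulMap_mul (j x)).sub_const (j x)
  have h3 (x : B) : Null atTop fun i => lact (j x) (D i) - ract (j x) (D i) := hD.central (j x)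
  have h4 (x : B) := h.null_mul_twoSidedUnit hb' (h3 x) (h2 x)
  have h5 (x : B) := h.null_twoSidedUnit_mul hb' (h3 x) (h1 x)
  refine ⟨ι, _, ‹_›, ‹_›, fun i => compress j P Q (D i), ⟨?_, fun x => ?_, fun x => ?_, fun x => ?_⟩⟩
  · obtain ⟨K, hK⟩ := normBdd_mapSq_compress (j := j) (P := P) (Q := Q) he he hb
    exact ⟨K, fun i => eventually_top.1 hK i⟩
  · exact tendsto_sub_nhds_zero_iff.1 (h.null_mul_mulMap_compress hb' (h1 x) (h4 x))
  · exact tendsto_sub_nhds_zero_iff.1 (h.null_mulMap_compress_mul hb' (h2 x) (h5 x))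
  · exact h.null_central_compress hb' (h3 x) (h4 x) (h5 x)

end IsComplementedIdealOfRetract

end Retract

/-! ### Projections, upper retracts and partial sums of the grading -/

section Grading

open ProjTensorSq

namespace IsGradedOver

section

variable {A : Type*} [NonUnitalNormedRing A] [NormedSpace ℂ A]
  {S : Type*} [CommSemigroup S] [Fintype S] {𝒜 : S → Submodule ℂ A}

/-- The ℓ¹ norm identity for x - y makes a sum of norms vanish. -/
theorem eq_of_sum_eq (h : IsGradedOver 𝒜) {x y : ∀ s, 𝒜 s}
    (hxy : ∑ s, (x s : A) = ∑ s, (y s : A)) : x = y := by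
  have h1 := h.norm_sum (x - y)
  have h2 : ∑ s, ((x - y) s : A) = 0 := by simp [Finset.sum_sub_distrib, hxy]
  rw [h2, norm_zero, eq_comm, Finset.sum_eq_zero_iff_of_nonneg fun _ _ => norm_nonneg _] at h1
  ext s
  simpa [sub_eq_zero] using h1 s (Finset.mem_univ s)

/-- The components of `a`. -/
noncomputable def comps (h : IsGradedOver 𝒜) (a : A) : ∀ s, 𝒜 s := (h.exists_sum a).choose

theorem sum_comps (h : IsGradedOver 𝒜) (a : A) : ∑ s, (h.comps a s : A) = a :=
  (h.exists_sum a).choose_spec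

theorem comps_eq (h : IsGradedOver 𝒜) {a : A} {x : ∀ s, 𝒜 s} (hx : ∑ s, (x s : A) = a) :
    h.comps a = x :=
  h.eq_of_sum_eq ((h.sum_comps a).trans hx.symm)

/-- The projection of `A` onto its component of index `s`. -/
noncomputable def proj (h : IsGradedOver 𝒜) (s : S) : A →L[ℂ] 𝒜 s :=
  LinearMap.mkContinuous
    { toFun := fun a => h.comps a s
      map_add' := fun a b => by
        rw [h.comps_eq (x := h.comps a + h.comps b)]
        · rfl
        · simp [Finset.sum_add_distrib, h.sum_comps]
      map_smul' := fun c a => by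
        rw [h.comps_eq (x := c • h.comps a)]
        · rfl
        · simp [← Finset.smul_sum, h.sum_comps] }
    1 fun a => by
      rw [one_mul]
      conv_rhs => rw [← h.sum_comps a, h.norm_sum]
      exact Finset.single_le_sum (f := fun t => ‖(h.comps a t : A)‖) (fun _ _ => norm_nonneg _)
        (Finset.mem_univ s)

theorem sum_proj (h : IsGradedOver 𝒜) (a : A) : ∑ s, (h.proj s a : A) = a := h.sum_comps a

theorem proj_of_mem (h : IsGradedOver 𝒜) {s : S} {a : A} (ha : a ∈ 𝒜 s) :
    h.proj s a = ⟨a, ha⟩ := by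
  classical
  have := h.comps_eq (a := a) (x := Pi.single s ⟨a, ha⟩) (by
    rw [Finset.sum_eq_single s] <;> simp +contextual)
  exact (congrFun this s).trans (by simp)

theorem proj_of_mem_of_ne (h : IsGradedOver 𝒜) {s t : S} {a : A} (ha : a ∈ 𝒜 s) (hst : t ≠ s) :
    h.proj t a = 0 := by
  classical
  have := h.comps_eq (a := a) (x := Pi.single s ⟨a, ha⟩) (by
    rw [Finset.sum_eq_single s] <;> simp +contextual)
  exact (congrFun this t).trans (by simp [hst])

/-- An additive property holds everywhere if it holds for the homogeneous elements. -/
theorem induction_homogeneous (h : IsGradedOver 𝒜) {p : A → Prop} (h0 : p 0)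
    (hadd : ∀ a b, p a → p b → p (a + b)) (hom : ∀ s, ∀ a ∈ 𝒜 s, p a) (a : A) : p a := by
  rw [← h.sum_proj a]
  exact Finset.sum_induction _ p hadd h0 fun s _ => hom s _ (h.proj s a).2

open Classical in
/-- The projection of `A` onto the sum of the components whose index lies above `s`. -/
noncomputable def upperProj (h : IsGradedOver 𝒜) (s : S) : A →L[ℂ] A :=
  ∑ t with s * t = s, (𝒜 t).subtypeL.comp (h.proj t)

theorem upperProj_of_mem (h : IsGradedOver 𝒜) {s t : S} (hst : s * t = s) {a : A} (ha : a ∈ 𝒜 t) :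
    h.upperProj s a = a := by
  classical
  rw [upperProj, sum_apply, Finset.sum_eq_single t]
  · simp [h.proj_of_mem ha]
  · intro r _ hr
    simp [h.proj_of_mem_of_ne ha hr]
  · simp [hst]

theorem upperProj_of_mem_of_ne (h : IsGradedOver 𝒜) {s t : S} (hst : s * t ≠ s) {a : A}
    (ha : a ∈ 𝒜 t) : h.upperProj s a = 0 := by
  classical
  rw [upperProj, sum_apply]
  refine Finset.sum_eq_zero fun r hr => ?_
  have : r ≠ t := by rintro rfl; exact hst (Finset.mem_filter.1 hr).2
  simp [h.proj_of_mem_of_ne ha this]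

/-- The indices above s form a subsemigroup whose complement is an ideal of `S`, so the projection
kills exactly the homogeneous products it should. -/
theorem upperProj_mul (h : IsGradedOver 𝒜) (hS : ∀ s : S, s * s = s) (s : S) (a b : A) :
    h.upperProj s (a * b) = h.upperProj s a * h.upperProj s b := by
  induction a using h.induction_homogeneous with
  | h0 => simp
  | hadd a a' ha ha' => simp [add_mul, ha, ha']
  | hom t a ha =>
  induction b using h.induction_homogeneous with
  | h0 => simp
  | hadd b b' hb hb' => simp [mul_add, hb, hb']
  | hom r b hb =>
  have hab := h.mul_mem t r a ha b hb
  by_cases hst : s * t = s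
  · by_cases hsr : s * r = s
    · rw [h.upperProj_of_mem (by rw [← mul_assoc, hst, hsr]) hab, h.upperProj_of_mem hst ha,
        h.upperProj_of_mem hsr hb]
    · rw [h.upperProj_of_mem_of_ne (by rwa [← mul_assoc, hst]) hab,
        h.upperProj_of_mem_of_ne hsr hb, mul_zero]
  · rw [h.upperProj_of_mem_of_ne _ hab, h.upperProj_of_mem_of_ne hst ha, zero_mul]
    -- A factor of an element above s is itself above s: multiply s = s(tr) by t and absorb tt = t.
    intro hstr
    apply hst
    calc s * t = s * (t * r) * t := by rw [hstr]
      _ = s * (t * t * r) := by ac_rfl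
      _ = s := by rw [hS, hstr]

/-- Only components with t above s survive, and then ts = s. -/
theorem upperProj_mul_mem (h : IsGradedOver 𝒜) {s : S} (a : A) {x : A} (hx : x ∈ 𝒜 s) :
    h.upperProj s a * x ∈ 𝒜 s := by
  induction a using h.induction_homogeneous with
  | h0 => simp
  | hadd a a' ha ha' => simpa [add_mul] using add_mem ha ha'
  | hom t a ha =>
  by_cases hst : s * t = s
  · rw [h.upperProj_of_mem hst ha]
    have := h.mul_mem t s a ha x hx
    rwa [mul_comm, hst] at this
  · simp [h.upperProj_of_mem_of_ne hst ha]

theorem mul_upperProj_mem (h : IsGradedOver 𝒜) {s : S} (a : A) {x : A} (hx : x ∈ 𝒜 s) :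
    x * h.upperProj s a ∈ 𝒜 s := by
  induction a using h.induction_homogeneous with
  | h0 => simp
  | hadd a a' ha ha' => simpa [mul_add] using add_mem ha ha'
  | hom t a ha =>
  by_cases hst : s * t = s
  · rw [h.upperProj_of_mem hst ha]
    have := h.mul_mem s t x hx a ha
    rwa [hst] at this
  · simp [h.upperProj_of_mem_of_ne hst ha]

/-- The inclusion of a component. -/
noncomputable def inclusion (h : IsGradedOver 𝒜) (hS : ∀ s : S, s * s = s) (s : S) :
    h.component hS s →L[ℂ] A :=
  LinearMap.mkContinuous
    { toFun := fun x => (x : A)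
      map_add' := fun _ _ => rfl
      map_smul' := fun _ _ => rfl } 1 fun x => (one_mul ‖x‖).ge

/-- The projection onto a component, as a map into the Banach algebra `h.component hS s`. -/
noncomputable def projComponent (h : IsGradedOver 𝒜) (hS : ∀ s : S, s * s = s) (s : S) :
    A →L[ℂ] h.component hS s :=
  LinearMap.mkContinuous
    { toFun := fun a => ⟨h.proj s a, (h.proj s a).2⟩
      map_add' := fun a b => Subtype.ext (by simp)
      map_smul' := fun c a => Subtype.ext (by simp) } ‖h.proj s‖ fun a => (h.proj s).le_opNorm a

theorem inclusion_projComponent_of_mem (h : IsGradedOver 𝒜) (hS : ∀ s : S, s * s = s) {s : S}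
    {a : A} (ha : a ∈ 𝒜 s) : h.inclusion hS s (h.projComponent hS s a) = a :=
  congrArg Subtype.val (h.proj_of_mem ha)

theorem isComplementedIdealOfRetract [IsScalarTower ℂ A A] [SMulCommClass ℂ A A]
    (h : IsGradedOver 𝒜) (hS : ∀ s : S, s * s = s) (s : S) :
    IsComplementedIdealOfRetract (h.inclusion hS s) (h.projComponent hS s) (h.upperProj s) where
  norm_map _ := rfl
  map_mul _ _ := rfl
  proj_apply x := Subtype.ext (h.inclusion_projComponent_of_mem hS x.2)
  hom_mul := h.upperProj_mul hS s
  hom_apply x := h.upperProj_of_mem (hS s) x.2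
  mul_mem a x := h.inclusion_projComponent_of_mem hS (h.upperProj_mul_mem a x.2)
  mem_mul a x := h.inclusion_projComponent_of_mem hS (h.mul_upperProj_mem a x.2)

/-- The sum of the components with index in `T`. -/
noncomputable def partialSum (h : IsGradedOver 𝒜) (T : Finset S) : Submodule ℂ A :=
  ⨅ t : {t // t ∉ T}, LinearMap.ker (h.proj t).toLinearMap

theorem mem_partialSum (h : IsGradedOver 𝒜) {T : Finset S} {a : A} :
    a ∈ h.partialSum T ↔ ∀ t ∉ T, h.proj t a = 0 := by
  simp [partialSum, Submodule.mem_iInf]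

/-- This is the benefit of describing the partial sum by kernels: a sum of closed subspaces need not
be closed in general. -/
theorem isClosed_partialSum (h : IsGradedOver 𝒜) (T : Finset S) :
    IsClosed (h.partialSum T : Set A) := by
  rw [partialSum, Submodule.coe_iInf]
  exact isClosed_iInter fun t => (h.proj t.1).isClosed_ker

theorem le_partialSum (h : IsGradedOver 𝒜) {T : Finset S} {s : S} (hs : s ∈ T) :
    𝒜 s ≤ h.partialSum T := fun a ha => h.mem_partialSum.2 fun t ht =>
  h.proj_of_mem_of_ne ha (by rintro rfl; exact ht hs)

theorem eq_sum_of_mem_partialSum (h : IsGradedOver 𝒜) {T : Finset S} {a : A}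
    (ha : a ∈ h.partialSum T) : a = ∑ t ∈ T, (h.proj t a : A) := by
  conv_lhs => rw [← h.sum_proj a]
  symm
  refine Finset.sum_subset (Finset.subset_univ T) fun t _ ht => ?_
  rw [h.mem_partialSum.1 ha t ht, Submodule.coe_zero]

theorem mul_mem_partialSum (h : IsGradedOver 𝒜) {T : Finset S} (hT : ∀ t ∈ T, ∀ r, t * r ∈ T)
    {a : A} (ha : a ∈ h.partialSum T) (b : A) : a * b ∈ h.partialSum T := by
  rw [h.eq_sum_of_mem_partialSum ha, ← h.sum_proj b, Finset.sum_mul_sum]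
  exact sum_mem fun t ht => sum_mem fun r _ =>
    h.le_partialSum (hT t ht r) (h.mul_mem _ _ _ (h.proj t a).2 _ (h.proj r b).2)

theorem mem_partialSum_mul (h : IsGradedOver 𝒜) {T : Finset S} (hT : ∀ t ∈ T, ∀ r, t * r ∈ T)
    (a : A) {b : A} (hb : b ∈ h.partialSum T) : a * b ∈ h.partialSum T := by
  rw [h.eq_sum_of_mem_partialSum hb, ← h.sum_proj a, Finset.sum_mul_sum]
  refine sum_mem fun t _ => sum_mem fun r hr => h.le_partialSum (s := t * r) ?_
    (h.mul_mem _ _ _ (h.proj t a).2 _ (h.proj r b).2)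
  rw [mul_comm]
  exact hT r hr t

theorem partialSum_insert [DecidableEq S] (h : IsGradedOver 𝒜) {T : Finset S} {s : S} :
    h.partialSum (insert s T) = h.partialSum T ⊔ 𝒜 s := by
  refine le_antisymm (fun a ha => ?_) (sup_le (fun a ha => ?_)
    (h.le_partialSum (Finset.mem_insert_self s T)))
  · by_cases hs : s ∈ T
    · rw [Finset.insert_eq_of_mem hs] at ha
      exact Submodule.mem_sup_left ha
    rw [h.eq_sum_of_mem_partialSum ha, Finset.sum_insert hs]
    exact add_mem (Submodule.mem_sup_right (h.proj s a).2)
      (Submodule.mem_sup_left (sum_mem fun t ht => h.le_partialSum ht (h.proj t a).2))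
  · exact h.mem_partialSum.2 fun t ht =>
      h.mem_partialSum.1 ha t fun h' => ht (Finset.mem_insert_of_mem h')

theorem partialSum_univ (h : IsGradedOver 𝒜) : h.partialSum Finset.univ = ⊤ :=
  eq_top_iff.2 fun _ _ => h.mem_partialSum.2 fun t ht => (ht (Finset.mem_univ t)).elim

theorem partialSum_empty (h : IsGradedOver 𝒜) : h.partialSum ∅ = ⊥ :=
  eq_bot_iff.2 fun _ ha => by simpa using h.eq_sum_of_mem_partialSum ha

end

end IsGradedOver

/-- Maximality for the order r ≤ s iff sr = r: take s with the most elements below it. If t ≥ s, the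
lower set of t contains that of s, so they coincide by counting, and t ≤ s. -/
theorem exists_maximal_of_idempotent {S : Type*} [CommSemigroup S] [Fintype S]
    (hS : ∀ s : S, s * s = s) {T : Finset S} (hT : T.Nonempty) :
    ∃ s ∈ T, ∀ t ∈ T, t * s = s → t = s := by
  classical
  obtain ⟨s, hs, hmax⟩ := T.exists_max_image (fun s => (Finset.univ.filter fun r => s * r = r).card) hT
  refine ⟨s, hs, fun t ht hts => ?_⟩
  have hsub : (Finset.univ.filter fun r => s * r = r) ⊆ Finset.univ.filter fun r => t * r = r := by
    intro r hr
    simp only [Finset.mem_filter, Finset.mem_univ, true_and] at hr ⊢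
    rw [← hr, ← mul_assoc, hts]
  have heq := Finset.eq_of_subset_of_card_le hsub (hmax t ht)
  have : t ∈ Finset.univ.filter fun r => s * r = r := by rw [heq]; simp [hS]
  simp only [Finset.mem_filter, Finset.mem_univ, true_and] at this
  rw [← this, mul_comm s t, hts]

/-! ### Passing between nets and filters, and induction over ideals of `S` -/

section Amenable

variable {A : Type u} [NonUnitalNormedRing A] [NormedSpace ℂ A]
  [IsScalarTower ℂ A A] [SMulCommClass ℂ A A] [CompleteSpace A]

theorem isApproxDiagFor_bot : IsApproxDiagFor (⊥ : Submodule ℂ A) (pure 0) where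
  neBot := inferInstance
  bdd := ⟨0, by simp⟩
  mem := by simp
  mul_mulMap a ha := by
    rw [(Submodule.mem_bot ℂ).1 ha]; exact tendsto_const_nhds.congr fun _ => by simp
  mulMap_mul a ha := by
    rw [(Submodule.mem_bot ℂ).1 ha]; exact tendsto_const_nhds.congr fun _ => by simp
  central a ha := tendsto_pure_left.2 fun s hs => by simpa using mem_of_mem_nhds hs

/-- A bounded approximate diagonal for all of `A` along a filter gives one along a net. -/
theorem IsApproxDiagFor.isAmenable {l : Filter (ProjTensorSq A)}
    (h : IsApproxDiagFor (⊤ : Submodule ℂ A) l) : IsAmenable A := by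
  classical
  have := h.neBot
  obtain ⟨K, hK⟩ := h.bdd
  have key (i : Finset A × ℕ) : ∃ D : ProjTensorSq A, ‖D‖ ≤ K ∧ ∀ a ∈ i.1,
      ‖a * mulMap A D - a‖ < 1 / ((i.2 : ℝ) + 1) ∧ ‖mulMap A D * a - a‖ < 1 / ((i.2 : ℝ) + 1) ∧
        ‖lact a D - ract a D‖ < 1 / ((i.2 : ℝ) + 1) := by
    have hε : (0 : ℝ) < 1 / ((i.2 : ℝ) + 1) := by positivity
    refine (hK.and ((Filter.eventually_all_finset i.1).2 fun a _ => ?_)).exists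
    have h1 := NormedAddGroup.tendsto_nhds_zero.1 (h.mul_mulMap a trivial) _ hε
    have h2 := NormedAddGroup.tendsto_nhds_zero.1 (h.mulMap_mul a trivial) _ hε
    have h3 := NormedAddGroup.tendsto_nhds_zero.1 (h.central a trivial) _ hε
    filter_upwards [h1, h2, h3] with D d1 d2 d3 using ⟨d1, d2, d3⟩
  choose D hD hDa using key
  have null {E : Type u} [NormedAddCommGroup E] (a : A) (w : Finset A × ℕ → E)
      (hw : ∀ i, a ∈ i.1 → ‖w i‖ < 1 / ((i.2 : ℝ) + 1)) : Tendsto w atTop (𝓝 0) := by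
    refine NormedAddGroup.tendsto_nhds_zero.2 fun ε hε => ?_
    obtain ⟨n, hn⟩ := exists_nat_one_div_lt hε
    filter_upwards [eventually_ge_atTop (({a} : Finset A), n)] with i hi
    refine (hw i (Finset.singleton_subset_iff.1 hi.1)).trans (lt_of_le_of_lt ?_ hn)
    have : (n : ℝ) ≤ i.2 := Nat.cast_le.2 hi.2
    gcongr
  -- This index set lies in the universe of `A`, as `IsAmenable` requires.
  exact ⟨Finset A × ℕ, inferInstance, inferInstance, inferInstance, D, ⟨⟨K, hD⟩,
    fun a => tendsto_sub_nhds_zero_iff.1 (null a _ fun i hi => (hDa i a hi).1),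
    fun a => tendsto_sub_nhds_zero_iff.1 (null a _ fun i hi => (hDa i a hi).2.1),
    fun a => null a _ fun i hi => (hDa i a hi).2.2⟩⟩

/-- The image of a bounded approximate diagonal under a bounded homomorphism. -/
theorem IsAmenable.exists_isApproxDiagFor {B : Type u} [NonUnitalNormedRing B] [NormedSpace ℂ B]
    [IsScalarTower ℂ B B] [SMulCommClass ℂ B B] [CompleteSpace B] (hB : IsAmenable B)
    (j : B →L[ℂ] A) (hj : ∀ x y, j (x * y) = j x * j y) {C : Submodule ℂ A}
    (hC : ∀ a, a ∈ C ↔ ∃ x, j x = a) : ∃ l, IsApproxDiagFor C l := by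
  obtain ⟨ι, _, _, _, D, hD⟩ := hB
  have hm (E : ProjTensorSq B) : mulMap A (mapSq j j E) = j (mulMap B E) := by
    have : (mulMap A).comp (mapSq j j) = j.comp (mulMap B) :=
      clm_ext fun b c => by simp [mapSq_tmul, mulMap_tmul, hj]
    exact congr($this E)
  have hl (x : B) (E : ProjTensorSq B) : lact (j x) (mapSq j j E) = mapSq j j (lact x E) := by
    have : (lact (j x)).comp (mapSq j j) = (mapSq j j).comp (lact x) :=
      clm_ext fun b c => by simp [mapSq_tmul, lact_tmul, hj]
    exact congr($this E)
  have hr (x : B) (E : ProjTensorSq B) : ract (j x) (mapSq j j E) = mapSq j j (ract x E) := by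
    have : (ract (j x)).comp (mapSq j j) = (mapSq j j).comp (ract x) :=
      clm_ext fun b c => by simp [mapSq_tmul, ract_tmul, hj]
    exact congr($this E)
  have hb : NormBdd atTop D := let ⟨K, hK⟩ := hD.bounded; ⟨K, .of_forall hK⟩
  refine ⟨map (fun i => mapSq j j (D i)) atTop, inferInstance, hb.clm (mapSq j j), ?_, fun a ha => ?_,
    fun a ha => ?_, fun a ha => ?_⟩
  · exact eventually_map.2 (.of_forall fun i => (hC _).2 ⟨_, (hm _).symm⟩)
  all_goals obtain ⟨x, rfl⟩ := (hC a).1 ha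
  · have h1 : Null atTop fun i => x * mulMap B (D i) - x :=
      tendsto_sub_nhds_zero_iff.2 (hD.mul_mulMap x)
    exact Null.map ((h1.clm j).congr fun i => by simp [hm, hj])
  · have h1 : Null atTop fun i => mulMap B (D i) * x - x :=
      tendsto_sub_nhds_zero_iff.2 (hD.mulMap_mul x)
    exact Null.map ((h1.clm j).congr fun i => by simp [hm, hj])
  · have h1 : Null atTop fun i => lact x (D i) - ract x (D i) := hD.central x
    exact Null.map ((h1.clm (mapSq j j)).congr fun i => by simp [hl, hr])

variable {S : Type v} [CommSemigroup S] [Fintype S] {𝒜 : S → Submodule ℂ A}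

/-- Induction over the ideals T of `S`: removing a maximal s leaves an ideal, whose partial sum is a
closed ideal of A, and the component of s is glued on. -/
theorem IsGradedOver.exists_isApproxDiagFor_partialSum (h : IsGradedOver 𝒜)
    (hS : ∀ s : S, s * s = s) (hA : ∀ s, ∃ l, IsApproxDiagFor (𝒜 s) l) (T : Finset S)
    (hT : ∀ t ∈ T, ∀ r, t * r ∈ T) : ∃ l, IsApproxDiagFor (h.partialSum T) l := by
  classical
  induction T using Finset.strongInduction with
  | H T ih =>
  rcases T.eq_empty_or_nonempty with rfl | hne
  · rw [h.partialSum_empty]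
    exact ⟨_, isApproxDiagFor_bot⟩
  obtain ⟨s, hs, hmax⟩ := exists_maximal_of_idempotent hS hne
  have hT' : ∀ t ∈ T.erase s, ∀ r, t * r ∈ T.erase s := by
    intro t ht r
    rw [Finset.mem_erase] at ht ⊢
    -- If tr = s then ts = ttr = s, so t lies above the maximal s and equals it.
    refine ⟨fun htr => ht.1 (hmax t ht.2 ?_), hT t ht.2 r⟩
    rw [← htr, ← mul_assoc, hS]
  obtain ⟨l, hl⟩ := ih _ (Finset.erase_ssubset hs) hT'
  obtain ⟨m, hm⟩ := hA s
  rw [← Finset.insert_erase hs, h.partialSum_insert]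
  exact exists_isApproxDiagFor_sup (h.isClosed_partialSum _)
    (fun a b hb => h.mem_partialSum_mul hT' a hb) (fun a ha b => h.mul_mem_partialSum hT' ha b) hl hm

end Amenable

end Grading

theorem proposition2p1 {A : Type*} [NonUnitalNormedRing A] [NormedSpace ℂ A]
    [IsScalarTower ℂ A A] [SMulCommClass ℂ A A] [CompleteSpace A]
    {S : Type*} [CommSemigroup S] [Fintype S] (hS : ∀ s : S, s * s = s)
    (𝒜 : S → Submodule ℂ A) (h : IsGradedOver 𝒜) :
    IsAmenable A ↔ ∀ s : S, IsAmenable (h.component hS s) := by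
  refine ⟨fun hA s => (h.isComplementedIdealOfRetract hS s).isAmenable hA, fun hA => ?_⟩
  obtain ⟨l, hl⟩ := h.exists_isApproxDiagFor_partialSum hS (fun s =>
    (hA s).exists_isApproxDiagFor (h.inclusion hS s) (fun _ _ => rfl)
      fun a => ⟨fun ha => ⟨⟨a, ha⟩, rfl⟩, fun ⟨x, hx⟩ => hx ▸ x.2⟩) Finset.univ (by simp)
  rw [h.partialSum_univ] at hl
  exact hl.isAmenable
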